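/- Let $n\ge 1$ and let $\mathfrak h_n$ be the real Heisenberg Lie algebra with basis $y_1,\dots,y_{2n},z$ and brackets $[y_i,y_j]=\delta_{j,i+n}\,z$ for $i<j$, $z$ central. Let $h$ be the inner product on $\mathfrak h_n$ for which this basis is orthonormal. Let $\mathcal C^\bullet=\bigwedge^\bullet\mathfrak h_n^\vee$ be the Cartan–Chevalley–Eilenberg complex, with differential $d$ the odd derivation such that $(d\varphi)(x,y)=\varphi([x,y])$ for $\varphi\in\mathfrak h_n^\vee$. Let $d^*$ be the adjoint of $d$ for the inner product on $\mathcal C^\bullet$ induced by $h$, and $\Delta=dd^*+d^*d$. Let $\mathcal C_B^\bullet=\bigwedge^\bullet H^1(\mathfrak h_n)\subseteq\mathcal C^\bullet$, where $H^1(\mathfrak h_n)\subseteq\mathfrak h_n^\vee$ is the space of linear forms $\varphi$ with $d\varphi=0$. The subalgebra $\mathcal C_B^\bullet$ is preserved by $\Delta$; let $\Delta_B$ be the restriction of $\Delta$ to it, a diagonalizable operator. For real $s\ge 0$ and real $t$ put $$Z_{\mathfrak h_n,h}(s,t)=\operatorname{Tr}\bigl(s^{\Delta_B}\,t^{\deg}\bigr),$$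 the trace being taken over $\mathcal C_B^\bullet$, where $s^{\Delta_B}$ acts as $s^\mu$ on the $\mu$-eigenspace of $\Delta_B$ (with $0^0=1$) and $t^{\deg}$ acts as $t^m$ on forms of degree $m$. Then $$Z_{\mathfrak h_n,h}(s,t)=\sum_{k=0}^n\ \sum_{m=0}^{n-k}\ \sum_{j=0}^{\min(m,\,n-k-m)} N_{n,k,j}\; s^{(m-j)(n-k-m-j+1)}\,t^{2m+k},$$ where $N_{n,k,0}=2^k\binom nk$ and, for $j\ge 1$, $$N_{n,k,j}=2^k\binom{n}{k,\;j,\;n-k-j}\,\frac{n-k-2j+1}{n-k-j+1}.$$ -/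

import Mathlib

open Module

noncomputable section

namespace TwoStep

/-! ### The Cartan-Chevalley-Eilenberg complex -/

section Complex

variable (L : Type*) [LieRing L] [LieAlgebra ℝ L]

/-- The underlying algebra of the Cartan-Chevalley-Eilenberg complex: the exterior algebra of the
dual of `L`. -/
abbrev CE : Type _ := ExteriorAlgebra ℝ (Dual ℝ L)

variable {L}

/-- Contraction (interior product) of forms with a vector `x`: the odd derivation of the exterior
algebra with `φ ↦ φ x` on linear forms. The value of a 2-form `ω` on `(x, y)` is the scalar
`contr y (contr x ω)`. -/
def contr : L →ₗ[ℝ] End ℝ (CE L) :=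
  (CliffordAlgebra.contractLeft (Q := (0 : QuadraticForm ℝ (Dual ℝ L)))) ∘ₗ Dual.eval ℝ L

theorem contr_one (x : L) : contr x (1 : CE L) = 0 :=
  CliffordAlgebra.contractLeft_one _ _

theorem contr_ι (x : L) (φ : Dual ℝ L) :
    contr x (ExteriorAlgebra.ι ℝ φ) = algebraMap ℝ (CE L) (φ x) :=
  CliffordAlgebra.contractLeft_ι _ _ _

theorem contr_algebraMap (x : L) (r : ℝ) : contr x (algebraMap ℝ (CE L) r) = 0 :=
  CliffordAlgebra.contractLeft_algebraMap _ _ _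

theorem contr_ι_mul (x : L) (φ : Dual ℝ L) (a : CE L) :
    contr x (ExteriorAlgebra.ι ℝ φ * a) = φ x • a - ExteriorAlgebra.ι ℝ φ * contr x a :=
  CliffordAlgebra.contractLeft_ι_mul _ _ _

theorem contr_contr_self (x : L) (a : CE L) : contr x (contr x a) = 0 :=
  CliffordAlgebra.contractLeft_contractLeft _ _

variable (L) in
/-- Left multiplication by a linear form. -/
def wedge : Dual ℝ L →ₗ[ℝ] End ℝ (CE L) :=
  (Algebra.lmul ℝ (CE L)).toLinearMap ∘ₗ ExteriorAlgebra.ι ℝ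

theorem wedge_apply (φ : Dual ℝ L) (a : CE L) : wedge L φ a = ExteriorAlgebra.ι ℝ φ * a := rfl

theorem ce_induction {C : CE L → Prop} (one : C 1) (add : ∀ a b, C a → C b → C (a + b))
    (smul : ∀ (r : ℝ) a, C a → C (r • a))
    (ι_mul : ∀ φ a, C a → C (ExteriorAlgebra.ι ℝ φ * a)) (a : CE L) : C a := by
  induction a using CliffordAlgebra.left_induction with
  | algebraMap r => rw [Algebra.algebraMap_eq_smul_one]; exact smul r _ one
  | add a b ha hb => exact add a b ha hb
  | ι_mul a φ ha => exact ι_mul φ a ha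

theorem contr_ιMulti (x : L) {k : ℕ} (ψ : Fin (k + 1) → Dual ℝ L) :
    contr x (ExteriorAlgebra.ιMulti ℝ (k + 1) ψ) =
      ∑ i : Fin (k + 1), ((-1) ^ (i : ℕ) * ψ i x) • ExteriorAlgebra.ιMulti ℝ k (ψ ∘ i.succAbove) := by
  induction k with
  | zero =>
    rw [ExteriorAlgebra.ιMulti_succ_apply, contr_ι_mul]
    simp [contr_one]
  | succ k ih =>
    rw [ExteriorAlgebra.ιMulti_succ_apply, contr_ι_mul, ih, Finset.mul_sum,
      Fin.sum_univ_succ (n := k + 1), sub_eq_add_neg, ← Finset.sum_neg_distrib]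
    congr 1
    · simp [Matrix.vecTail, Function.comp_def]
    · refine Finset.sum_congr rfl fun i _ => ?_
      rw [ExteriorAlgebra.ιMulti_succ_apply (v := ψ ∘ i.succ.succAbove), mul_smul_comm, ← neg_smul]
      congr 1
      · simp [Matrix.vecTail, pow_succ]
      · congr 2
        ext j
        simp [Matrix.vecTail]

variable [FiniteDimensional ℝ L]

variable (L) in
/-- The Cartan-Chevalley-Eilenberg differential
`d = ∑_{i<j} e^i ∧ e^j ∧ contr [e_i, e_j] = 1/2 ∑_{i,j} e^i ∧ e^j ∧ contr [e_i, e_j]`,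
where `e` is a basis of `L` and `e^i` are the dual linear forms. By `ceDiff_one`, `ceDiff_ι_mul` and
`ceDiff_ι_eval` below it is the odd derivation with `(d φ)(x, y) = φ [x, y]` for linear forms `φ`;
in particular it does not depend on the basis. -/
def ceDiff : End ℝ (CE L) :=
  (1 / 2 : ℝ) • ∑ i, ∑ j, wedge L ((finBasis ℝ L).coord i) * wedge L ((finBasis ℝ L).coord j) *
    contr ⁅finBasis ℝ L i, finBasis ℝ L j⁆

theorem ceDiff_apply (a : CE L) : ceDiff L a = (1 / 2 : ℝ) • ∑ i, ∑ j,
    ExteriorAlgebra.ι ℝ ((finBasis ℝ L).coord i) * (ExteriorAlgebra.ι ℝ ((finBasis ℝ L).coord j) *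
    contr ⁅finBasis ℝ L i, finBasis ℝ L j⁆ a) := by
  simp [ceDiff, LinearMap.sum_apply, wedge_apply]

theorem ceDiff_one : ceDiff L (1 : CE L) = 0 := by
  simp [ceDiff_apply, contr_one]

theorem ceDiff_ι (φ : Dual ℝ L) : ceDiff L (ExteriorAlgebra.ι ℝ φ) = (1 / 2 : ℝ) • ∑ i, ∑ j,
    φ ⁅finBasis ℝ L i, finBasis ℝ L j⁆ • (ExteriorAlgebra.ι ℝ ((finBasis ℝ L).coord i) *
      ExteriorAlgebra.ι ℝ ((finBasis ℝ L).coord j)) := by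
  simp only [ceDiff_apply, contr_ι, Algebra.algebraMap_eq_smul_one, mul_smul_comm, mul_one]

/-- `d` is an odd derivation. -/
theorem ceDiff_ι_mul (φ : Dual ℝ L) (a : CE L) :
    ceDiff L (ExteriorAlgebra.ι ℝ φ * a) =
      ceDiff L (ExteriorAlgebra.ι ℝ φ) * a - ExteriorAlgebra.ι ℝ φ * ceDiff L a := by
  have anti : ∀ (α β : Dual ℝ L) (c : CE L), ExteriorAlgebra.ι ℝ α * (ExteriorAlgebra.ι ℝ β * c) =
      -(ExteriorAlgebra.ι ℝ β * (ExteriorAlgebra.ι ℝ α * c)) := by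
    intro α β c
    rw [← mul_assoc, ← mul_assoc, ← neg_mul,
      eq_neg_of_add_eq_zero_left (ExteriorAlgebra.ι_add_mul_swap α β)]
  rw [ceDiff_ι, ceDiff_apply, ceDiff_apply, smul_mul_assoc, mul_smul_comm, ← smul_sub]
  congr 1
  rw [Finset.sum_mul, Finset.mul_sum, ← Finset.sum_sub_distrib]
  refine Finset.sum_congr rfl fun i _ => ?_
  rw [Finset.sum_mul, Finset.mul_sum, ← Finset.sum_sub_distrib]
  refine Finset.sum_congr rfl fun j _ => ?_
  rw [contr_ι_mul, mul_sub, mul_sub, mul_smul_comm, mul_smul_comm, smul_mul_assoc, mul_assoc,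
    anti ((finBasis ℝ L).coord j) φ, mul_neg, anti ((finBasis ℝ L).coord i) φ, neg_neg]

theorem sum_coord_smul (x : L) :
    ∑ i, (finBasis ℝ L).coord i x • finBasis ℝ L i = x :=
  (finBasis ℝ L).sum_repr x

/-- `(d φ)(x, y) = φ [x, y]`. -/
theorem ceDiff_ι_eval (φ : Dual ℝ L) (x y : L) :
    contr y (contr x (ceDiff L (ExteriorAlgebra.ι ℝ φ))) = algebraMap ℝ (CE L) (φ ⁅x, y⁆) := by
  have key : ∀ u v : L, ∑ i, ∑ j, φ ⁅finBasis ℝ L i, finBasis ℝ L j⁆ *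
      ((finBasis ℝ L).coord i u * (finBasis ℝ L).coord j v) = φ ⁅u, v⁆ := by
    intro u v
    conv_rhs => rw [← sum_coord_smul u, ← sum_coord_smul v]
    rw [sum_lie, map_sum]
    refine Finset.sum_congr rfl fun i _ => ?_
    rw [smul_lie, lie_sum, map_smul, map_sum, smul_eq_mul, Finset.mul_sum]
    refine Finset.sum_congr rfl fun j _ => ?_
    rw [lie_smul, map_smul, smul_eq_mul]
    ring
  have h2 : φ ⁅x, y⁆ = (1 / 2 : ℝ) * (φ ⁅x, y⁆ - φ ⁅y, x⁆) := by
    rw [← lie_skew x y, map_neg]; ring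
  rw [h2, ← key x y, ← key y x, ceDiff_ι, ← Finset.sum_sub_distrib]
  simp only [← Finset.sum_sub_distrib, map_smul, map_sum, contr_ι_mul, contr_ι, map_sub,
    Algebra.algebraMap_eq_smul_one, mul_smul_comm, mul_one, Finset.mul_sum, Finset.smul_sum]
  refine Finset.sum_congr rfl fun i _ => Finset.sum_congr rfl fun j _ => ?_
  simp only [← sub_smul, smul_smul]
  congr 1
  ring

variable (L) in
/-- `H¹(L)`. As `d` vanishes in degree zero, this is the space of closed linear forms. -/
def H1 : Submodule ℝ (Dual ℝ L) := LinearMap.ker (ceDiff L ∘ₗ ExteriorAlgebra.ι ℝ)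

theorem mem_H1_iff (φ : Dual ℝ L) : φ ∈ H1 L ↔ ∀ x y : L, φ ⁅x, y⁆ = 0 := by
  constructor
  · intro h x y
    have := ceDiff_ι_eval φ x y
    rw [show ceDiff L (ExteriorAlgebra.ι ℝ φ) = 0 from h, map_zero, map_zero] at this
    exact (ExteriorAlgebra.algebraMap_eq_zero_iff _ _).1 this.symm
  · intro h
    change ceDiff L (ExteriorAlgebra.ι ℝ φ) = 0
    simp [ceDiff_ι, h]

variable (L) in
/-- The subalgebra `⋀ H¹(L)` of the Cartan-Chevalley-Eilenberg complex, that is, the subalgebra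
generated by `H¹(L)`. -/
def basicCE : Subalgebra ℝ (CE L) := Algebra.adjoin ℝ (ExteriorAlgebra.ι ℝ '' (H1 L : Set (Dual ℝ L)))

instance : FiniteDimensional ℝ (CE L) :=
  Module.Finite.of_basis (finBasis ℝ (Dual ℝ L)).ExteriorAlgebra

end Complex

/-! ### Metric pairs -/

/-- A metric pair: a 2-step nilpotent real Lie algebra `L` together with a positive definite inner
product on the underlying vector space. -/
structure MetricPair (L : Type*) [LieRing L] [LieAlgebra ℝ L] where
  two_step : ∀ x y z : L, ⁅x, ⁅y, z⁆⁆ = 0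
  /-- The inner product. -/
  form : LinearMap.BilinForm ℝ L
  symm : ∀ x y, form x y = form y x
  pos : ∀ x, x ≠ 0 → 0 < form x x

namespace MetricPair

variable {L : Type*} [LieRing L] [LieAlgebra ℝ L] (P : MetricPair L)

theorem nondegenerate : P.form.Nondegenerate := by
  constructor
  · intro x hx
    by_contra h
    exact (P.pos x h).ne' (hx x)
  · intro x hx
    by_contra h
    exact (P.pos x h).ne' (hx x)

variable [FiniteDimensional ℝ L]

/-- The vector representing a linear form with respect to the inner product. -/
def sharp : Dual ℝ L ≃ₗ[ℝ] L := (P.form.toDual P.nondegenerate).symm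

theorem form_sharp (φ : Dual ℝ L) (x : L) : P.form (P.sharp φ) x = φ x :=
  LinearMap.BilinForm.apply_toDual_symm_apply (hB := P.nondegenerate) φ x

theorem sharp_form (x : L) : P.sharp (P.form x) = x :=
  (P.form.toDual P.nondegenerate).symm_apply_apply x

/-- Iterated contraction with the vectors `P.sharp φ`: `P.contrAlg (φ₁ ∧ ⋯ ∧ φₖ)` is contraction
with `P.sharp φ₁`, followed by contraction with `P.sharp φ₂`, and so on. -/
def contrAlg : CE L →ₐ[ℝ] (End ℝ (CE L))ᵐᵒᵖ :=
  ExteriorAlgebra.lift ℝ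
    ⟨(MulOpposite.opLinearEquiv ℝ).toLinearMap ∘ₗ contr ∘ₗ P.sharp.toLinearMap, fun φ => by
      apply MulOpposite.unop_injective
      ext a
      exact contr_contr_self _ _⟩

theorem contrAlg_ι (φ : Dual ℝ L) :
    (P.contrAlg (ExteriorAlgebra.ι ℝ φ)).unop = contr (P.sharp φ) := by
  rw [contrAlg, ExteriorAlgebra.lift_ι_apply]
  rfl

/-- The inner product on the exterior algebra of the dual of `L` induced by the inner product of
`L`: forms of different degrees are orthogonal and
`⟪φ₁ ∧ ⋯ ∧ φₖ, ψ₁ ∧ ⋯ ∧ ψₖ⟫ = det ⟪φᵢ, ψⱼ⟫`, see `innerCE_ιMulti` and `innerCE_ιMulti_of_ne`. -/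
def innerCE : LinearMap.BilinForm ℝ (CE L) :=
  (LinearMap.llcomp ℝ (CE L) (CE L) ℝ (ExteriorAlgebra.algebraMapInv (R := ℝ)).toLinearMap) ∘ₗ
    (MulOpposite.opLinearEquiv ℝ).symm.toLinearMap ∘ₗ P.contrAlg.toLinearMap

theorem innerCE_apply (a b : CE L) : P.innerCE a b =
    (ExteriorAlgebra.algebraMapInv (R := ℝ) (M := Dual ℝ L)) ((P.contrAlg a).unop b) := rfl

theorem innerCE_one (b : CE L) :
    P.innerCE 1 b = (ExteriorAlgebra.algebraMapInv (R := ℝ) (M := Dual ℝ L)) b := by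
  rw [innerCE_apply, map_one]
  rfl

theorem innerCE_ι_mul (φ : Dual ℝ L) (a b : CE L) :
    P.innerCE (ExteriorAlgebra.ι ℝ φ * a) b = P.innerCE a (contr (P.sharp φ) b) := by
  rw [innerCE_apply, innerCE_apply, map_mul, MulOpposite.unop_mul, contrAlg_ι]
  rfl

theorem innerCE_ιMulti_of_ne {k l : ℕ} (h : k ≠ l) (φ : Fin k → Dual ℝ L) (ψ : Fin l → Dual ℝ L) :
    P.innerCE (ExteriorAlgebra.ιMulti ℝ k φ) (ExteriorAlgebra.ιMulti ℝ l ψ) = 0 := by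
  induction k generalizing l with
  | zero =>
    obtain ⟨l, rfl⟩ := Nat.exists_eq_succ_of_ne_zero h.symm
    rw [ExteriorAlgebra.ιMulti_zero_apply, innerCE_one, ExteriorAlgebra.ιMulti_succ_apply, map_mul]
    simp [ExteriorAlgebra.algebraMapInv]
  | succ k ih =>
    rw [ExteriorAlgebra.ιMulti_succ_apply, innerCE_ι_mul]
    cases l with
    | zero => simp [contr_one]
    | succ l =>
      rw [contr_ιMulti, map_sum]
      refine Finset.sum_eq_zero fun i _ => ?_
      rw [map_smul, ih (by omega), smul_zero]

theorem innerCE_ιMulti {k : ℕ} (φ ψ : Fin k → Dual ℝ L) :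
    P.innerCE (ExteriorAlgebra.ιMulti ℝ k φ) (ExteriorAlgebra.ιMulti ℝ k ψ) =
      (Matrix.of fun i j => P.form (P.sharp (φ i)) (P.sharp (ψ j))).det := by
  have hs : ∀ α β : Dual ℝ L, P.form (P.sharp α) (P.sharp β) = β (P.sharp α) := fun α β => by
    rw [P.symm, form_sharp]
  induction k with
  | zero => simp [innerCE_one]
  | succ k ih =>
    rw [ExteriorAlgebra.ιMulti_succ_apply, innerCE_ι_mul, contr_ιMulti, map_sum,
      Matrix.det_succ_row_zero]
    refine Finset.sum_congr rfl fun i _ => ?_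
    rw [map_smul, ih, smul_eq_mul, Matrix.of_apply, hs]
    rfl

theorem exists_orthogonal_basis : ∃ (n : ℕ) (e : Basis (Fin n) ℝ (Dual ℝ L)),
    (∀ i j, i ≠ j → P.form (P.sharp (e i)) (P.sharp (e j)) = 0) ∧
    ∀ i, 0 < P.form (P.sharp (e i)) (P.sharp (e i)) := by
  obtain ⟨v, hv⟩ := LinearMap.BilinForm.exists_orthogonal_basis (B := P.form) ⟨P.symm⟩
  refine ⟨_, v.map P.sharp.symm, fun i j hij => ?_, fun i => ?_⟩
  · simpa using hv hij
  · simpa using P.pos _ (v.ne_zero i)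

/-- The monomials in an orthogonal basis form an orthogonal basis. -/
theorem exists_orthogonal_basis_CE : ∃ (n : ℕ) (E : Basis (Finset (Fin n)) ℝ (CE L)),
    (∀ S T, S ≠ T → P.innerCE (E S) (E T) = 0) ∧ ∀ S, 0 < P.innerCE (E S) (E S) := by
  obtain ⟨n, e, h0, h1⟩ := P.exists_orthogonal_basis
  refine ⟨n, e.ExteriorAlgebra, fun S T hST => ?_, fun S => ?_⟩
  · by_cases hc : S.card = T.card
    · rw [ExteriorAlgebra.basis_apply_ofCard e hc, ExteriorAlgebra.basis_apply_ofCard e rfl,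
        ExteriorAlgebra.ιMulti_family, ExteriorAlgebra.ιMulti_family, innerCE_ιMulti]
      obtain ⟨i, hiS, hiT⟩ : ∃ i ∈ S, i ∉ T := by
        by_contra! hcon
        exact hST (Finset.eq_of_subset_of_card_le hcon hc.ge)
      obtain ⟨k, hk⟩ := (Set.powersetCard.mem_range_ofFinEmbEquiv_symm_iff_mem
        (Set.powersetCard.ofCard hc) i).mpr hiS
      apply Matrix.det_eq_zero_of_row_eq_zero k
      intro j
      rw [Matrix.of_apply, Function.comp_apply, Function.comp_apply, hk]
      apply h0
      rintro rfl
      apply hiT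
      exact (Set.powersetCard.mem_range_ofFinEmbEquiv_symm_iff_mem
        (Set.powersetCard.ofCard (rfl : T.card = T.card)) _).mp ⟨j, rfl⟩
    · rw [ExteriorAlgebra.basis_apply_ofCard e rfl, ExteriorAlgebra.basis_apply_ofCard e rfl]
      exact P.innerCE_ιMulti_of_ne hc _ _
  · rw [ExteriorAlgebra.basis_apply_ofCard e rfl, ExteriorAlgebra.ιMulti_family, innerCE_ιMulti]
    rw [show (Matrix.of fun i j => _ : Matrix (Fin S.card) (Fin S.card) ℝ) =
      Matrix.diagonal fun i => P.form
        (P.sharp (e (Set.powersetCard.ofFinEmbEquiv.symm (Set.powersetCard.ofCard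
          (rfl : S.card = S.card)) i)))
        (P.sharp (e (Set.powersetCard.ofFinEmbEquiv.symm (Set.powersetCard.ofCard
          (rfl : S.card = S.card)) i))) from ?_, Matrix.det_diagonal]
    · exact Finset.prod_pos fun i _ => h1 _
    · ext i j
      rw [Matrix.diagonal_apply]
      split_ifs with h
      · subst h
        rfl
      · exact h0 _ _ fun h' => h ((Set.powersetCard.ofFinEmbEquiv.symm _).injective h')

theorem innerCE_symm (a b : CE L) : P.innerCE a b = P.innerCE b a := by
  obtain ⟨n, E, h0, -⟩ := P.exists_orthogonal_basis_CE
  have : P.innerCE = P.innerCE.flip := by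
    refine LinearMap.BilinForm.ext_basis E fun S T => ?_
    rw [LinearMap.BilinForm.flip_apply]
    by_cases h : S = T
    · rw [h]
    · rw [h0 S T h, h0 T S (Ne.symm h)]
  exact LinearMap.congr_fun₂ this a b

theorem innerCE_pos (a : CE L) (ha : a ≠ 0) : 0 < P.innerCE a a := by
  obtain ⟨n, E, h0, h1⟩ := P.exists_orthogonal_basis_CE
  have key : P.innerCE a a = ∑ S, E.repr a S ^ 2 * P.innerCE (E S) (E S) := by
    conv_lhs => rw [← E.sum_repr a]
    simp only [map_sum, LinearMap.sum_apply, map_smul, LinearMap.smul_apply, smul_eq_mul]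
    refine Finset.sum_congr rfl fun S _ => ?_
    rw [Finset.sum_eq_single S]
    · ring
    · intro T _ hT
      rw [h0 T S hT, mul_zero]
    · simp
  rw [key]
  obtain ⟨S, hS⟩ : ∃ S, E.repr a S ≠ 0 := by
    by_contra! h
    exact ha (E.repr.map_eq_zero_iff.1 (Finsupp.ext h))
  exact Finset.sum_pos' (fun S _ => mul_nonneg (sq_nonneg _) (h1 S).le)
    ⟨S, Finset.mem_univ _, mul_pos (by positivity) (h1 S)⟩

theorem innerCE_nondegenerate : P.innerCE.Nondegenerate := by
  constructor
  · intro x hx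
    by_contra h
    exact (P.innerCE_pos x h).ne' (hx x)
  · intro x hx
    by_contra h
    exact (P.innerCE_pos x h).ne' (hx x)

theorem innerCE_ext {a a' : CE L} (h : ∀ b, P.innerCE a b = P.innerCE a' b) : a = a' := by
  rw [← sub_eq_zero]
  by_contra hne
  refine (P.innerCE_pos _ hne).ne' ?_
  rw [LinearMap.BilinForm.sub_left, h, sub_self]

/-- The adjoint Cartan-Chevalley-Eilenberg operator `d^*`: the adjoint of `d` with respect to the
induced inner product. -/
def ceCodiff : End ℝ (CE L) :=
  P.innerCE.leftAdjointOfNondegenerate P.innerCE_nondegenerate (ceDiff L)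

theorem innerCE_ceCodiff (a b : CE L) : P.innerCE (P.ceCodiff a) b = P.innerCE a (ceDiff L b) :=
  LinearMap.BilinForm.isAdjointPairLeftAdjointOfNondegenerate _ P.innerCE_nondegenerate _ a b

/-- The Laplacian `Δ = d d^* + d^* d`. -/
def laplacian : End ℝ (CE L) := ceDiff L * P.ceCodiff + P.ceCodiff * ceDiff L

theorem innerCE_ι_mul_right (φ : Dual ℝ L) (a b : CE L) :
    P.innerCE a (ExteriorAlgebra.ι ℝ φ * b) = P.innerCE (contr (P.sharp φ) a) b := by
  rw [P.innerCE_symm, innerCE_ι_mul, P.innerCE_symm]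

theorem innerCE_contr_right (x : L) (a b : CE L) :
    P.innerCE a (contr x b) = P.innerCE (ExteriorAlgebra.ι ℝ (P.form x) * a) b := by
  rw [innerCE_ι_mul, sharp_form]

theorem ceCodiff_apply (a : CE L) : P.ceCodiff a = (1 / 2 : ℝ) • ∑ i, ∑ j,
    ExteriorAlgebra.ι ℝ (P.form ⁅finBasis ℝ L i, finBasis ℝ L j⁆) *
      (contr (P.sharp ((finBasis ℝ L).coord j)) (contr (P.sharp ((finBasis ℝ L).coord i)) a)) := by
  refine P.innerCE_ext fun b => ?_
  rw [innerCE_ceCodiff, ceDiff_apply, LinearMap.BilinForm.smul_left,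
    LinearMap.BilinForm.smul_right, LinearMap.BilinForm.sum_left, LinearMap.BilinForm.sum_right]
  congr 1
  refine Finset.sum_congr rfl fun i _ => ?_
  rw [LinearMap.BilinForm.sum_left, LinearMap.BilinForm.sum_right]
  refine Finset.sum_congr rfl fun j _ => ?_
  rw [innerCE_ι_mul_right, innerCE_ι_mul_right, innerCE_contr_right]

theorem basicCE_induction {C : CE L → Prop} (one : C 1) (add : ∀ a b, C a → C b → C (a + b))
    (smul : ∀ (r : ℝ) a, C a → C (r • a))
    (ι_mul : ∀ φ ∈ H1 L, ∀ a ∈ basicCE L, C a → C (ExteriorAlgebra.ι ℝ φ * a)) {a : CE L}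
    (ha : a ∈ basicCE L) : C a := by
  suffices h : ∀ b ∈ basicCE L, C b → C (a * b) by
    simpa using h 1 (one_mem _) one
  induction ha using Algebra.adjoin_induction with
  | mem x hx =>
    obtain ⟨φ, hφ, rfl⟩ := hx
    exact fun b hb h => ι_mul φ hφ b hb h
  | algebraMap r => exact fun b _ h => by rw [← Algebra.smul_def]; exact smul r b h
  | add x y _ _ hx hy => exact fun b hb h => by rw [add_mul]; exact add _ _ (hx b hb h) (hy b hb h)
  | mul x y _ hy' hx hy =>
    exact fun b hb h => by
      rw [mul_assoc]; exact hx _ (mul_mem hy' hb) (hy b hb h)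

theorem ι_mem_basicCE {φ : Dual ℝ L} (hφ : φ ∈ H1 L) : ExteriorAlgebra.ι ℝ φ ∈ basicCE L :=
  Algebra.subset_adjoin ⟨φ, hφ, rfl⟩

theorem contr_mem_basicCE (x : L) {a : CE L} (ha : a ∈ basicCE L) : contr x a ∈ basicCE L := by
  refine basicCE_induction (C := fun a => contr x a ∈ basicCE L) ?_ ?_ ?_ ?_ ha
  · rw [contr_one]; exact zero_mem _
  · intro a b ha hb; rw [map_add]; exact add_mem ha hb
  · intro r a ha; rw [map_smul]; exact (basicCE L).smul_mem ha r
  · intro φ hφ a ha h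
    rw [contr_ι_mul]
    exact sub_mem ((basicCE L).smul_mem ha _) (mul_mem (ι_mem_basicCE hφ) h)

/-- `d` vanishes on basic forms. -/
theorem ceDiff_eq_zero_of_mem {a : CE L} (ha : a ∈ basicCE L) : ceDiff L a = 0 := by
  refine basicCE_induction (C := fun a => ceDiff L a = 0) ?_ ?_ ?_ ?_ ha
  · exact ceDiff_one
  · intro a b ha hb; rw [map_add, ha, hb, add_zero]
  · intro r a ha; rw [map_smul, ha, smul_zero]
  · intro φ hφ a ha h
    rw [ceDiff_ι_mul, h, show ceDiff L (ExteriorAlgebra.ι ℝ φ) = 0 from hφ, zero_mul, mul_zero,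
      sub_zero]

theorem sum_smul_coord (ψ : Dual ℝ L) : ∑ j, ψ (finBasis ℝ L j) • (finBasis ℝ L).coord j = ψ := by
  refine (finBasis ℝ L).ext fun i => ?_
  simp

theorem ceDiff_ι_mem_basicCE (h2 : ∀ x y z : L, ⁅x, ⁅y, z⁆⁆ = 0) (φ : Dual ℝ L) :
    ceDiff L (ExteriorAlgebra.ι ℝ φ) ∈ basicCE L := by
  let F : L →ₗ[ℝ] CE L := ExteriorAlgebra.ι ℝ ∘ₗ (LinearMap.llcomp ℝ L L ℝ φ) ∘ₗ
    (LieAlgebra.ad ℝ L : L →ₗ[ℝ] End ℝ L)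
  have hF : ∀ x, F x = ExteriorAlgebra.ι ℝ (φ ∘ₗ LieAlgebra.ad ℝ L x) := fun x => rfl
  have hFmem : ∀ x, F x ∈ basicCE L := fun x => ι_mem_basicCE <| by
    rw [mem_H1_iff]
    intro u v
    change φ ⁅x, ⁅u, v⁆⁆ = 0
    rw [h2, map_zero]
  have hd : ceDiff L (ExteriorAlgebra.ι ℝ φ) =
      (1 / 2 : ℝ) • ∑ i, ExteriorAlgebra.ι ℝ ((finBasis ℝ L).coord i) * F (finBasis ℝ L i) := by
    rw [ceDiff_ι]
    congr 1
    refine Finset.sum_congr rfl fun i _ => ?_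
    rw [hF, ← sum_smul_coord (φ ∘ₗ LieAlgebra.ad ℝ L (finBasis ℝ L i)), map_sum, Finset.mul_sum]
    refine Finset.sum_congr rfl fun j _ => ?_
    rw [map_smul, mul_smul_comm]
    rfl
  let D : Submodule ℝ L := Submodule.span ℝ {z | ∃ x y : L, ⁅x, y⁆ = z}
  obtain ⟨f, hf⟩ := LinearMap.exists_leftInverse_of_injective D.subtype D.ker_subtype
  let p : L →ₗ[ℝ] L := LinearMap.id - D.subtype ∘ₗ f
  have hpD : ∀ x y, p ⁅x, y⁆ = 0 := fun x y => by
    have : D.subtype (f (D.subtype ⟨⁅x, y⁆, Submodule.subset_span ⟨x, y, rfl⟩⟩)) = ⁅x, y⁆ := by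
      rw [← LinearMap.comp_apply f, hf]
      rfl
    change ⁅x, y⁆ - D.subtype (f ⁅x, y⁆) = 0
    rw [sub_eq_zero]
    exact this.symm
  have hFD : ∀ z ∈ D, F z = 0 := fun z hz => by
    induction hz using Submodule.span_induction with
    | mem z hz =>
      obtain ⟨x, y, rfl⟩ := hz
      rw [hF]
      convert map_zero (ExteriorAlgebra.ι ℝ (M := Dual ℝ L))
      ext w
      change φ ⁅⁅x, y⁆, w⁆ = 0
      rw [← lie_skew, h2, neg_zero, map_zero]
    | zero => exact map_zero F
    | add x y _ _ hx hy => rw [map_add, hx, hy, add_zero]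
    | smul r x _ hx => rw [map_smul, hx, smul_zero]
  have hFp : ∀ x, F x = F (p x) := fun x => by
    change F x = F (x - D.subtype (f x))
    rw [map_sub, show F (D.subtype (f x)) = 0 from hFD _ (f x).2, sub_zero]
  have hd2 : ∑ i, ExteriorAlgebra.ι ℝ ((finBasis ℝ L).coord i) * F (finBasis ℝ L i) =
      ∑ k, ExteriorAlgebra.ι ℝ ((finBasis ℝ L).coord k ∘ₗ p) * F (finBasis ℝ L k) := by
    have h1 : ∀ i, ExteriorAlgebra.ι ℝ ((finBasis ℝ L).coord i) * F (finBasis ℝ L i) =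
        ∑ k, (finBasis ℝ L).coord k (p (finBasis ℝ L i)) •
          (ExteriorAlgebra.ι ℝ ((finBasis ℝ L).coord i) * F (finBasis ℝ L k)) := fun i => by
      rw [hFp]
      conv_lhs => rw [← sum_coord_smul (p (finBasis ℝ L i))]
      rw [map_sum, Finset.mul_sum]
      refine Finset.sum_congr rfl fun k _ => ?_
      rw [map_smul, mul_smul_comm]
    rw [Finset.sum_congr rfl fun i _ => h1 i, Finset.sum_comm]
    refine Finset.sum_congr rfl fun k _ => ?_
    rw [← sum_smul_coord ((finBasis ℝ L).coord k ∘ₗ p), map_sum, Finset.sum_mul]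
    refine Finset.sum_congr rfl fun i _ => ?_
    rw [map_smul, smul_mul_assoc]
    rfl
  rw [hd, hd2]
  refine (basicCE L).smul_mem (sum_mem fun k _ => mul_mem (ι_mem_basicCE ?_) (hFmem _)) _
  rw [mem_H1_iff]
  intro x y
  rw [LinearMap.comp_apply, hpD, map_zero]

theorem laplacian_mem_basicCE {a : CE L} (ha : a ∈ basicCE L) : P.laplacian a ∈ basicCE L := by
  have h : P.laplacian a = ceDiff L (P.ceCodiff a) := by
    change ceDiff L (P.ceCodiff a) + P.ceCodiff (ceDiff L a) = _
    rw [ceDiff_eq_zero_of_mem ha, map_zero, add_zero]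
  rw [h, ceCodiff_apply, map_smul, map_sum]
  refine (basicCE L).smul_mem (sum_mem fun i _ => ?_) _
  rw [map_sum]
  refine sum_mem fun j _ => ?_
  have hw := contr_mem_basicCE (P.sharp ((finBasis ℝ L).coord j))
    (contr_mem_basicCE (P.sharp ((finBasis ℝ L).coord i)) ha)
  rw [ceDiff_ι_mul, ceDiff_eq_zero_of_mem hw, mul_zero, sub_zero]
  exact mul_mem (ceDiff_ι_mem_basicCE P.two_step _) hw

/-- The basic Laplacian `Δ_B`: the restriction of the Laplacian to basic forms. -/
def basicLaplacian : End ℝ (Subalgebra.toSubmodule (basicCE L)) :=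
  P.laplacian.restrict fun _ ha => P.laplacian_mem_basicCE ha

theorem innerCE_laplacian (a b : CE L) : P.innerCE (P.laplacian a) b =
    P.innerCE (P.ceCodiff a) (P.ceCodiff b) + P.innerCE (ceDiff L a) (ceDiff L b) := by
  have h : P.laplacian a = ceDiff L (P.ceCodiff a) + P.ceCodiff (ceDiff L a) := rfl
  rw [h, LinearMap.BilinForm.add_left, innerCE_ceCodiff, P.innerCE_symm (ceDiff L (P.ceCodiff a)),
    ← innerCE_ceCodiff, P.innerCE_symm (P.ceCodiff b)]

/-- The basic Laplacian is diagonalizable over the reals. -/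
theorem iSup_eigenspace_basicLaplacian : ⨆ μ : ℝ, P.basicLaplacian.eigenspace μ = ⊤ := by
  let c : InnerProductSpace.Core ℝ (Subalgebra.toSubmodule (basicCE L)) :=
    { inner := fun a b => P.innerCE a b
      conj_inner_symm := fun a b => P.innerCE_symm b a
      re_inner_nonneg := fun a => by
        by_cases h : (a : CE L) = 0
        · simp [h]
        · exact (P.innerCE_pos _ h).le
      add_left := fun a b d => LinearMap.BilinForm.add_left _ _ _
      smul_left := fun a b r => LinearMap.BilinForm.smul_left _ _ _
      definite := fun a h => by
        by_contra hne
        exact (P.innerCE_pos (a : CE L) (fun h0 => hne (Subtype.ext h0))).ne' h }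
  let _ : NormedAddCommGroup (Subalgebra.toSubmodule (basicCE L)) := c.toNormedAddCommGroup
  let _ : InnerProductSpace ℝ (Subalgebra.toSubmodule (basicCE L)) :=
    InnerProductSpace.ofCore c.toCore
  have hs : LinearMap.IsSymmetric P.basicLaplacian := fun a b => by
    change P.innerCE (P.laplacian a) b = P.innerCE a (P.laplacian b)
    rw [P.innerCE_symm a, innerCE_laplacian, innerCE_laplacian, P.innerCE_symm (P.ceCodiff a),
      P.innerCE_symm (ceDiff L a)]
  exact (Submodule.orthogonal_eq_bot_iff).1 hs.orthogonalComplement_iSup_eigenspaces_eq_bot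

end MetricPair

/-! ### Partition function -/

/-- The operator `s^T`, for a diagonalizable real endomorphism `T`: the polynomial in `T` that
interpolates `x ↦ s ^ x` at the eigenvalues of `T`. It acts as `s ^ μ` on the `μ`-eigenspace of `T`,
see `rpowEnd_apply`. -/
def rpowEnd {V : Type*} [AddCommGroup V] [Module ℝ V] (s : ℝ) (T : End ℝ V) : End ℝ V :=
  Polynomial.aeval T (Lagrange.interpolate (minpoly ℝ T).roots.toFinset id fun x => s ^ x)

theorem rpowEnd_apply {V : Type*} [AddCommGroup V] [Module ℝ V] [FiniteDimensional ℝ V] (s : ℝ)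
    (T : End ℝ V) (μ : ℝ) (v : V) (h : T v = μ • v) : rpowEnd s T v = s ^ μ • v := by
  by_cases hv : v = 0
  · simp [hv]
  have hev : T.HasEigenvector μ v := ⟨Module.End.mem_eigenspace_iff.2 h, hv⟩
  have hμ : μ ∈ (minpoly ℝ T).roots.toFinset := by
    rw [Multiset.mem_toFinset, Polynomial.mem_roots (minpoly.ne_zero (Algebra.IsIntegral.isIntegral T))]
    exact Module.End.isRoot_of_hasEigenvalue (Module.End.hasEigenvalue_of_hasEigenvector hev)
  rw [rpowEnd, Module.End.aeval_apply_of_hasEigenvector hev]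
  congr 1
  exact Lagrange.eval_interpolate_at_node (v := id) _ (Set.injOn_id _) hμ

section Degree

variable {L : Type*} [LieRing L] [LieAlgebra ℝ L]

variable (L) in
/-- The operator `t^deg`, which multiplies forms of degree `k` by `t ^ k` (see `degPow_apply`): the
algebra endomorphism induced by multiplication by `t` on linear forms. -/
def degPow (t : ℝ) : End ℝ (CE L) :=
  (ExteriorAlgebra.map (t • (LinearMap.id : Dual ℝ L →ₗ[ℝ] Dual ℝ L))).toLinearMap

theorem degPow_ι_mul (t : ℝ) (φ : Dual ℝ L) (a : CE L) :
    degPow L t (ExteriorAlgebra.ι ℝ φ * a) = t • (ExteriorAlgebra.ι ℝ φ * degPow L t a) := by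
  simp [degPow]

theorem degPow_one (t : ℝ) : degPow L t 1 = 1 := by
  simp [degPow]

theorem degPow_apply (t : ℝ) {k : ℕ} {a : CE L} (ha : a ∈ ⋀[ℝ]^k (Dual ℝ L)) :
    degPow L t a = t ^ k • a := by
  rw [← ExteriorAlgebra.ιMulti_span_fixedDegree] at ha
  induction ha using Submodule.span_induction with
  | mem x hx =>
    obtain ⟨v, rfl⟩ := hx
    induction k with
    | zero => simp [degPow_one]
    | succ k ih =>
      rw [ExteriorAlgebra.ιMulti_succ_apply, degPow_ι_mul, ih, mul_smul_comm, smul_smul, pow_succ']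
  | zero => simp
  | add x y _ _ hx hy => rw [map_add, hx, hy, smul_add]
  | smul r x _ hx => rw [map_smul, hx, smul_comm]

theorem degPow_mem_basicCE [FiniteDimensional ℝ L] (t : ℝ) {a : CE L} (ha : a ∈ basicCE L) :
    degPow L t a ∈ basicCE L := by
  refine MetricPair.basicCE_induction (C := fun a => degPow L t a ∈ basicCE L) ?_ ?_ ?_ ?_ ha
  · rw [degPow_one]; exact one_mem _
  · intro a b ha hb; rw [map_add]; exact add_mem ha hb
  · intro r a ha; rw [map_smul]; exact (basicCE L).smul_mem ha r
  · intro φ hφ a ha h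
    rw [degPow_ι_mul]
    exact (basicCE L).smul_mem (mul_mem (MetricPair.ι_mem_basicCE hφ) h) t

/-- The basic partition function `Z(s, t) = Tr (s^{Δ_B} t^deg)`, the trace being taken over basic
forms. -/
def MetricPair.basicPartitionFunction [FiniteDimensional ℝ L] (P : MetricPair L) (s t : ℝ) : ℝ :=
  LinearMap.trace ℝ (Subalgebra.toSubmodule (basicCE L))
    (rpowEnd s P.basicLaplacian * (degPow L t).restrict fun _ ha => degPow_mem_basicCE t ha)

end Degree

/-! ### Heisenberg Lie algebras -/

/-- The underlying vector space of the Heisenberg Lie algebra of dimension `2 n + 1`. The three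
summands of the index type label the standard basis vectors `y_1, …, y_n`, then
`y_{n+1}, …, y_{2n}`, and finally `z`. -/
def Heisenberg (n : ℕ) : Type := Fin n ⊕ Fin n ⊕ Unit → ℝ

namespace Heisenberg

variable {n : ℕ}

instance : AddCommGroup (Heisenberg n) := inferInstanceAs (AddCommGroup (Fin n ⊕ Fin n ⊕ Unit → ℝ))

instance : Module ℝ (Heisenberg n) := inferInstanceAs (Module ℝ (Fin n ⊕ Fin n ⊕ Unit → ℝ))

variable (n) in
/-- The standard basis. -/
def basis : Basis (Fin n ⊕ Fin n ⊕ Unit) ℝ (Heisenberg n) := Pi.basisFun ℝ _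

theorem basis_apply (p q : Fin n ⊕ Fin n ⊕ Unit) :
    (basis n p : Heisenberg n) q = if q = p then 1 else 0 := by
  change Pi.basisFun ℝ (Fin n ⊕ Fin n ⊕ Unit) p q = _
  rw [Pi.basisFun_apply, Pi.single_apply]

instance : FiniteDimensional ℝ (Heisenberg n) := Module.Finite.of_basis (basis n)

/-- `y_1, …, y_n` -/
def y (i : Fin n) : Heisenberg n := basis n (Sum.inl i)

/-- `y_{n+1}, …, y_{2n}` -/
def y' (i : Fin n) : Heisenberg n := basis n (Sum.inr (Sum.inl i))

/-- The central element. -/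
def z : Heisenberg n := basis n (Sum.inr (Sum.inr ()))

/-- The coefficient of `z` in the bracket of two vectors. -/
def omega (v w : Heisenberg n) : ℝ :=
  ∑ i : Fin n, (v (Sum.inl i) * w (Sum.inr (Sum.inl i)) - v (Sum.inr (Sum.inl i)) * w (Sum.inl i))

instance : Bracket (Heisenberg n) (Heisenberg n) := ⟨fun v w => omega v w • z⟩

theorem lie_def (v w : Heisenberg n) : ⁅v, w⁆ = omega v w • (z : Heisenberg n) := rfl

theorem omega_add_left (u v w : Heisenberg n) : omega (u + v) w = omega u w + omega v w := by
  rw [omega, omega, omega, ← Finset.sum_add_distrib]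
  refine Finset.sum_congr rfl fun i _ => ?_
  change (u _ + v _) * _ - (u _ + v _) * _ = _
  ring

theorem omega_skew (v w : Heisenberg n) : omega v w = -omega w v := by
  rw [omega, omega, ← Finset.sum_neg_distrib]
  exact Finset.sum_congr rfl fun i _ => by ring

theorem omega_add_right (u v w : Heisenberg n) : omega u (v + w) = omega u v + omega u w := by
  rw [omega_skew, omega_add_left, omega_skew u v, omega_skew u w, neg_add]

theorem omega_smul_right (r : ℝ) (v w : Heisenberg n) : omega v (r • w) = r * omega v w := by
  rw [omega, omega, Finset.mul_sum]
  refine Finset.sum_congr rfl fun i _ => ?_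
  change v _ * (r * w _) - v _ * (r * w _) = _
  ring

theorem omega_z_right (v : Heisenberg n) : omega v z = 0 := by
  simp [omega, z, basis_apply]

theorem lie_lie (u v w : Heisenberg n) : ⁅u, ⁅v, w⁆⁆ = 0 := by
  rw [lie_def v w, lie_def, omega_smul_right, omega_z_right, mul_zero, zero_smul]

instance : LieRing (Heisenberg n) where
  add_lie u v w := by rw [lie_def, lie_def, lie_def, omega_add_left, add_smul]
  lie_add u v w := by rw [lie_def, lie_def, lie_def, omega_add_right, add_smul]
  lie_self v := by
    rw [lie_def, self_eq_neg.1 (omega_skew v v), zero_smul]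
  leibniz_lie u v w := by
    have h : ∀ a b : Heisenberg n, ⁅⁅a, b⁆, w⁆ = 0 := fun a b => by
      rw [lie_def, omega_skew, lie_def, omega_smul_right, omega_z_right, mul_zero, neg_zero,
        zero_smul]
    rw [lie_lie, lie_lie, h, add_zero]

instance : LieAlgebra ℝ (Heisenberg n) where
  lie_smul r v w := by rw [lie_def, lie_def, omega_smul_right, mul_smul]

/-! The brackets of the standard basis vectors: `[y_i, y_j] = δ_{j, i + n} z` for `i < j`, and `z` is
central. -/

theorem lie_y_y' (i j : Fin n) : ⁅(y i : Heisenberg n), y' j⁆ = if i = j then z else 0 := by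
  have : omega (y i : Heisenberg n) (y' j) = if i = j then 1 else 0 := by
    simp [omega, y, y', basis_apply, eq_comm]
  rw [lie_def, this]
  split_ifs <;> simp

theorem lie_y_y (i j : Fin n) : ⁅(y i : Heisenberg n), y j⁆ = 0 := by
  have : omega (y i : Heisenberg n) (y j) = 0 := by
    simp [omega, y, basis_apply]
  rw [lie_def, this, zero_smul]

theorem lie_y'_y' (i j : Fin n) : ⁅(y' i : Heisenberg n), y' j⁆ = 0 := by
  have : omega (y' i : Heisenberg n) (y' j) = 0 := by
    simp [omega, y', basis_apply]
  rw [lie_def, this, zero_smul]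

theorem lie_z (v : Heisenberg n) : ⁅v, (z : Heisenberg n)⁆ = 0 := by
  rw [lie_def, omega_z_right, zero_smul]

variable (n) in
/-- The metric pair for which the standard basis of the Heisenberg Lie algebra is orthonormal. -/
def metricPair : MetricPair (Heisenberg n) where
  two_step := lie_lie
  form := LinearMap.mk₂ ℝ (fun v w : Heisenberg n => ∑ p, v p * w p)
    (fun u v w => by
      rw [← Finset.sum_add_distrib]
      exact Finset.sum_congr rfl fun p _ => add_mul (u p) (v p) (w p))
    (fun r v w => by
      rw [smul_eq_mul, Finset.mul_sum]
      exact Finset.sum_congr rfl fun p _ => mul_assoc r (v p) (w p))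
    (fun u v w => by
      rw [← Finset.sum_add_distrib]
      exact Finset.sum_congr rfl fun p _ => mul_add (u p) (v p) (w p))
    (fun r v w => by
      rw [smul_eq_mul, Finset.mul_sum]
      exact Finset.sum_congr rfl fun p _ => mul_left_comm (v p) r (w p))
  symm v w := by
    rw [LinearMap.mk₂_apply, LinearMap.mk₂_apply]
    exact Finset.sum_congr rfl fun p _ => mul_comm (v p) (w p)
  pos v hv := by
    rw [LinearMap.mk₂_apply]
    obtain ⟨p, hp⟩ : ∃ p, v p ≠ 0 := by
      by_contra! h
      exact hv (funext h)
    exact Finset.sum_pos' (fun q _ => mul_self_nonneg _)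
      ⟨p, Finset.mem_univ _, mul_self_pos.2 hp⟩

theorem metricPair_orthonormal (p q : Fin n ⊕ Fin n ⊕ Unit) :
    (metricPair n).form (basis n p) (basis n q) = if p = q then 1 else 0 := by
  rw [metricPair, LinearMap.mk₂_apply]
  simp [basis_apply, eq_comm]

variable (n) in
/-- The coefficients `N_{n,k,j}`, for `k + j ≤ n`. -/
def multiplicity (k j : ℕ) : ℝ :=
  if j = 0 then 2 ^ k * (n.choose k : ℝ)
  else 2 ^ k * (Nat.multinomial Finset.univ ![k, j, n - k - j] : ℝ) *
    (((n : ℝ) - k - 2 * j + 1) / ((n : ℝ) - k - j + 1))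

end Heisenberg

end TwoStep

end

/-! Write ω = d z^*, let E be multiplication by ω and F its adjoint, both acting on basic forms. On
the whole complex d = ω ∧ ι_z (`ceDiff_eq`) and d^* is z^* ∧ applied to an iterated contraction
(`ceCodiff_eq`). Since d and ι_z kill basic forms, Δ_B = E F (`basicLaplacian_eq`).

E creates and F annihilates pairs {y_i, y_{i+n}}, and the anticommutation relations between wedge
and contraction give the sl₂ relation [F, E] = n - deg. Sort monomials by the number m of complete
pairs and the number k of pairs met exactly once. E and F preserve k and change m by one. For fixed
k, with N = n - k, this is an sl₂-representation graded by m = 0, …, N with [F, E] = N - 2m on the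
m-th piece, whose dimension is 2^k C(n,k) C(N,m). A lowest weight vector at level j spans a string
on which E F has eigenvalue (m - j)(N - m - j + 1) at level m. The number of such strings is the
difference of two consecutive dimensions, which is N_{n,k,j} (`multiplicity_succ`).

No decomposition into irreducibles is carried out. Instead `trace_aeval_mul_proj` computes tr (f(E
F) π_m) for all polynomials f by induction on m: cyclicity of the trace moves positive powers of E F
from level m + 1 to level m, where F E = E F + N - 2m, and the constant term accounts for the
strings that begin or end.

The operator s^{Δ_B} is such a polynomial in Δ_B, interpolating s^x at the roots of the minimal
polynomial. To evaluate it at the numbers above, these must be roots; `isRoot_minpoly` gets this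
from the same trace formula and the positivity of the multiplicities. -/

noncomputable section

namespace TwoStep

/-! ### Traces of polynomials in a product of ladder operators -/

section Ladder

open Polynomial

variable {A : Type*} [Ring A] [Algebra ℝ A]

theorem mul_pow_succ_eq_mul_pow_mul {A : Type*} [Ring A] (E F : A) (r : ℕ) :
    (E * F) ^ (r + 1) = E * (F * E) ^ r * F := by
  induction r with
  | zero => simp
  | succ r ih => rw [pow_succ, ih, pow_succ]; noncomm_ring

variable {tr : A →ₗ[ℝ] ℝ} {E F : A} {π : ℕ → A} {N : ℕ}

/-- Write (E F)^(r+1) = E (F E)^r F, pull the projection through F, and rotate E to the end under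
the trace. This needs at least one factor E F; exponent 0 is the source of the correction term in
`trace_aeval_mul_proj_succ`. -/
theorem trace_pow_succ_mul_proj (htr : ∀ a b, tr (a * b) = tr (b * a))
    (hE : ∀ m, E * π m = π (m + 1) * E) (hF : ∀ m, F * π (m + 1) = π m * F) (r m : ℕ) :
    tr ((E * F) ^ (r + 1) * π (m + 1)) = tr ((F * E) ^ (r + 1) * π m) := by
  rw [mul_pow_succ_eq_mul_pow_mul, mul_assoc, hF, mul_assoc, htr, pow_succ, mul_assoc, mul_assoc,
    mul_assoc, mul_assoc, hE, ← mul_assoc F, hF, mul_assoc]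

/-- The commutator is a scalar only against `π m`. As F E commutes with `π m`, the relation can
nevertheless be used once per factor. -/
theorem pow_mul_proj (hE : ∀ m, E * π m = π (m + 1) * E) (hF : ∀ m, F * π (m + 1) = π m * F)
    (hH : ∀ m, (F * E - E * F) * π m = ((N : ℝ) - 2 * m) • π m) (r m : ℕ) :
    (F * E) ^ r * π m = (E * F + algebraMap ℝ A ((N : ℝ) - 2 * m)) ^ r * π m := by
  have hc : Commute (F * E) (π m) := by
    rw [Commute, SemiconjBy, mul_assoc, hE, ← mul_assoc, hF, mul_assoc]
  have h1 : F * E * π m = (E * F + algebraMap ℝ A ((N : ℝ) - 2 * m)) * π m := by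
    rw [add_mul, ← Algebra.smul_def, ← hH m]
    noncomm_ring
  induction r with
  | zero => simp
  | succ r ih =>
    rw [pow_succ', pow_succ', mul_assoc, (hc.pow_left r).eq, ← mul_assoc, h1, mul_assoc,
      ← (hc.pow_left r).eq, ih, mul_assoc]

/-- By linearity f may be a monomial. Positive powers pass to level m with a shift of the argument;
a constant only sees the change of the trace of the projection. -/
theorem trace_aeval_mul_proj_succ (htr : ∀ a b, tr (a * b) = tr (b * a))
    (hE : ∀ m, E * π m = π (m + 1) * E) (hF : ∀ m, F * π (m + 1) = π m * F)
    (hH : ∀ m, (F * E - E * F) * π m = ((N : ℝ) - 2 * m) • π m) (m : ℕ) (f : ℝ[X]) :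
    tr (aeval (E * F) f * π (m + 1)) =
      tr (aeval (E * F) (f.comp (X + C ((N : ℝ) - 2 * m))) * π m) +
        f.eval 0 * (tr (π (m + 1)) - tr (π m)) := by
  induction f using Polynomial.induction_on' with
  | add p q hp hq => simp only [map_add, add_mul, hp, hq, add_comp, eval_add]; ring
  | monomial r a =>
    rw [aeval_comp, map_add, aeval_X, aeval_C, aeval_monomial, aeval_monomial, eval_monomial,
      ← Algebra.smul_def, ← Algebra.smul_def, smul_mul_assoc, smul_mul_assoc, map_smul, map_smul]
    cases r with
    | zero => simp; ring
    | succ r =>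
      rw [trace_pow_succ_mul_proj htr hE hF, pow_mul_proj hE hF hH]
      simp

/-- The trace of a polynomial in `E * F` on the `m`-th piece of a graded representation of `sl₂`
with lowering operator `F` and raising operator `E`, where `δ j` is the number of lowest weight
vectors in the `j`-th piece. -/
theorem trace_aeval_mul_proj (htr : ∀ a b, tr (a * b) = tr (b * a))
    (hE : ∀ m, E * π m = π (m + 1) * E) (hF : ∀ m, F * π (m + 1) = π m * F) (hF0 : F * π 0 = 0)
    (hH : ∀ m, (F * E - E * F) * π m = ((N : ℝ) - 2 * m) • π m) (δ : ℕ → ℝ)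
    (hδ0 : δ 0 = tr (π 0)) (hδ : ∀ m < N, δ (m + 1) = tr (π (m + 1)) - tr (π m))
    (hsymm : ∀ m ≤ N, tr (π (N - m)) = tr (π m)) (m : ℕ) (hm : m ≤ N) (f : ℝ[X]) :
    tr (aeval (E * F) f * π m) = ∑ j ∈ Finset.range (min m (N - m) + 1),
      δ j * f.eval (((m - j) * (N - m - j + 1) : ℕ) : ℝ) := by
  induction m generalizing f with
  | zero =>
    have h0 : ∀ f : ℝ[X], aeval (E * F) f * π 0 = f.eval 0 • π 0 := fun f => by
      induction f using Polynomial.induction_on' with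
      | add p q hp hq => simp only [map_add, add_mul, hp, hq, eval_add, add_smul]
      | monomial r a =>
        rw [aeval_monomial, eval_monomial, ← Algebra.smul_def, smul_mul_assoc]
        cases r with
        | zero => simp
        | succ r => rw [pow_succ, mul_assoc, mul_assoc, hF0]; simp
    rw [h0]
    simp [hδ0, mul_comm]
  | succ m ih =>
    rw [trace_aeval_mul_proj_succ htr hE hF hH, ih (by omega), ← hδ m (by omega)]
    -- The shift N - 2m carries the eigenvalue of string j at level m to its eigenvalue at level m +
    -- 1: with p = m - j and N = m + 1 + j + q it says p(q + 2) + (N - 2m) = (p + 1)(q + 1).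
    have hs : ∀ j ∈ Finset.range (min m (N - (m + 1)) + 1),
        δ j * (f.comp (X + C ((N : ℝ) - 2 * m))).eval (((m - j) * (N - m - j + 1) : ℕ) : ℝ) =
        δ j * f.eval (((m + 1 - j) * (N - (m + 1) - j + 1) : ℕ) : ℝ) := fun j hj => by
      rw [Finset.mem_range] at hj
      obtain ⟨q, rfl⟩ : ∃ q, N = m + 1 + (j + q) := ⟨N - (m + 1) - j, by omega⟩
      obtain ⟨p, rfl⟩ : ∃ p, m = j + p := ⟨m - j, by omega⟩
      rw [eval_comp]
      congr 2
      rw [show j + p - j = p by omega, show j + p + 1 - j = p + 1 by omega,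
        show j + p + 1 + (j + q) - (j + p) - j + 1 = q + 2 by omega,
        show j + p + 1 + (j + q) - (j + p + 1) - j + 1 = q + 1 by omega]
      simp
      ring
    -- The range of j shrinks, stays or grows. Past the middle, the string j = N - m has ended: its
    -- shifted eigenvalue is 0 and by symmetry its coefficient cancels `δ (m + 1)`. If N = 2m + 1,
    -- symmetry gives `δ (m + 1)` = 0. Before the middle, the correction is the new string j = m +
    -- 1, with eigenvalue 0.
    rcases lt_trichotomy N (2 * m + 1) with h | h | h
    · rw [show min m (N - m) + 1 = (min m (N - (m + 1)) + 1) + 1 by omega, Finset.sum_range_succ,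
        Finset.sum_congr rfl hs, show min (m + 1) (N - (m + 1)) + 1 = min m (N - (m + 1)) + 1 by omega]
      obtain ⟨q, rfl⟩ : ∃ q, N = m + 1 + q := ⟨N - (m + 1), by omega⟩
      rw [show min m (m + 1 + q - (m + 1)) + 1 = q + 1 by omega]
      have e1 := hsymm m (by omega)
      have e2 := hsymm (m + 1) (by omega)
      rw [show m + 1 + q - m = q + 1 by omega] at e1
      rw [show m + 1 + q - (m + 1) = q by omega] at e2
      have e3 : (f.comp (X + C (((m + 1 + q : ℕ) : ℝ) - 2 * m))).eval
          (((m - (q + 1)) * (m + 1 + q - m - (q + 1) + 1) : ℕ) : ℝ) = f.eval 0 := by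
        rw [eval_comp]
        congr 1
        rw [show m + 1 + q - m - (q + 1) + 1 = 1 by omega, mul_one, Nat.cast_sub (by omega)]
        simp
        ring
      rw [e3, hδ m (by omega), hδ q (by omega), e1, e2]
      ring
    · have e1 := hsymm m (by omega)
      rw [show N - m = m + 1 by omega] at e1
      rw [hδ m (by omega), e1, sub_self, mul_zero, add_zero,
        show min m (N - m) + 1 = min m (N - (m + 1)) + 1 by omega, Finset.sum_congr rfl hs,
        show min (m + 1) (N - (m + 1)) + 1 = min m (N - (m + 1)) + 1 by omega]
    · have hmin : min m (N - (m + 1)) = m := by omega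
      rw [hmin] at hs
      rw [show min m (N - m) + 1 = m + 1 by omega, Finset.sum_congr rfl hs,
        show min (m + 1) (N - (m + 1)) + 1 = m + 1 + 1 by omega, Finset.sum_range_succ _ (m + 1),
        Nat.sub_self, zero_mul, Nat.cast_zero, mul_comm (eval 0 f)]

end Ladder

/-! ### Canonical anticommutation relations -/

section Fermion

variable {A : Type*} [Ring A] {ι : Type*} [Fintype ι] [DecidableEq ι]

/-- Canonical anticommutation relations between creation operators `c p` and annihilation operators
`a p`. -/
structure IsFermion {κ : Type*} [DecidableEq κ] (c a : κ → A) : Prop where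
  creation : ∀ p q, c p * c q + c q * c p = 0
  creation_self : ∀ p, c p * c p = 0
  annihilation : ∀ p q, a p * a q + a q * a p = 0
  annihilation_self : ∀ p, a p * a p = 0
  mixed : ∀ p q, a p * c q + c q * a p = if p = q then 1 else 0

variable (c a : ι ⊕ ι → A)

/-- The operator that creates pairs. -/
def pairCreation : A := ∑ i, c (.inl i) * c (.inr i)

/-- The operator that annihilates pairs. -/
def pairAnnihilation : A := ∑ i, a (.inr i) * a (.inl i)

/-- The operator that counts pairs. -/
def pairNumber : A := ∑ i, c (.inl i) * a (.inl i) * (c (.inr i) * a (.inr i))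

/-- The operator that counts particles. -/
def totalNumber : A := ∑ i, (c (.inl i) * a (.inl i) + c (.inr i) * a (.inr i))

variable {c a}

/-- Reduces a commutator with a product of two odd operators to anticommutators, which the fermion
relations evaluate. -/
theorem mul_mul_sub_mul_mul (x y z : A) :
    x * y * z - z * (x * y) = x * (y * z + z * y) - (x * z + z * x) * y := by noncomm_ring

namespace IsFermion

variable (h : IsFermion c a)
include h

theorem pairCreation_comm_creation (p : ι ⊕ ι) : pairCreation c * c p = c p * pairCreation c := by
  rw [← sub_eq_zero, pairCreation, Finset.sum_mul, Finset.mul_sum, ← Finset.sum_sub_distrib]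
  refine Finset.sum_eq_zero fun i _ => ?_
  rw [mul_mul_sub_mul_mul, h.creation, h.creation]; simp

theorem pairAnnihilation_comm_annihilation (p : ι ⊕ ι) :
    pairAnnihilation a * a p = a p * pairAnnihilation a := by
  rw [← sub_eq_zero, pairAnnihilation, Finset.sum_mul, Finset.mul_sum, ← Finset.sum_sub_distrib]
  refine Finset.sum_eq_zero fun i _ => ?_
  rw [mul_mul_sub_mul_mul, h.annihilation, h.annihilation]; simp

theorem pairCreation_annihilation_inl (i : ι) :
    pairCreation c * a (.inl i) - a (.inl i) * pairCreation c = -c (.inr i) := by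
  rw [pairCreation, Finset.sum_mul, Finset.mul_sum, ← Finset.sum_sub_distrib,
    Finset.sum_eq_single i]
  · rw [mul_mul_sub_mul_mul, add_comm (c (.inr i) * _), add_comm (c (.inl i) * _), h.mixed, h.mixed]
    simp
  · intro j _ hj
    rw [mul_mul_sub_mul_mul, add_comm (c (.inr j) * _), add_comm (c (.inl j) * _), h.mixed, h.mixed]
    simp [hj.symm]
  · simp

theorem pairCreation_annihilation_inr (i : ι) :
    pairCreation c * a (.inr i) - a (.inr i) * pairCreation c = c (.inl i) := by
  rw [pairCreation, Finset.sum_mul, Finset.mul_sum, ← Finset.sum_sub_distrib,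
    Finset.sum_eq_single i]
  · rw [mul_mul_sub_mul_mul, add_comm (c (.inr i) * _), add_comm (c (.inl i) * _), h.mixed, h.mixed]
    simp
  · intro j _ hj
    rw [mul_mul_sub_mul_mul, add_comm (c (.inr j) * _), add_comm (c (.inl j) * _), h.mixed, h.mixed]
    simp [hj.symm]
  · simp

theorem pairAnnihilation_creation_inl (i : ι) :
    pairAnnihilation a * c (.inl i) - c (.inl i) * pairAnnihilation a = a (.inr i) := by
  rw [pairAnnihilation, Finset.sum_mul, Finset.mul_sum, ← Finset.sum_sub_distrib,
    Finset.sum_eq_single i]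
  · rw [mul_mul_sub_mul_mul, h.mixed, h.mixed]
    simp
  · intro j _ hj
    rw [mul_mul_sub_mul_mul, h.mixed, h.mixed]
    simp [hj]
  · simp

theorem pairAnnihilation_creation_inr (i : ι) :
    pairAnnihilation a * c (.inr i) - c (.inr i) * pairAnnihilation a = -a (.inl i) := by
  rw [pairAnnihilation, Finset.sum_mul, Finset.mul_sum, ← Finset.sum_sub_distrib,
    Finset.sum_eq_single i]
  · rw [mul_mul_sub_mul_mul, h.mixed, h.mixed]
    simp
  · intro j _ hj
    rw [mul_mul_sub_mul_mul, h.mixed, h.mixed]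
    simp [hj]
  · simp

omit [Fintype ι] in
theorem annihilation_mul_creation (p : ι ⊕ ι) : a p * c p = 1 - c p * a p := by
  rw [eq_sub_iff_add_eq, h.mixed, if_pos rfl]

omit [Fintype ι] in
theorem annihilation_mul_creation_of_ne {p q : ι ⊕ ι} (hpq : p ≠ q) : a p * c q = -(c q * a p) := by
  rw [eq_neg_iff_add_eq_zero, h.mixed, if_neg hpq]

omit [Fintype ι] in
theorem creation_swap (p q : ι ⊕ ι) : c p * c q = -(c q * c p) :=
  eq_neg_of_add_eq_zero_left (h.creation p q)

omit [Fintype ι] in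
theorem annihilation_swap (p q : ι ⊕ ι) : a p * a q = -(a q * a p) :=
  eq_neg_of_add_eq_zero_left (h.annihilation p q)

/-- The commutator with F is a derivation; on the i-th pair it gives a_r c_r - c_l a_l = 1 - c_r a_r
- c_l a_l. -/
theorem pairAnnihilation_pairCreation :
    pairAnnihilation a * pairCreation c - pairCreation c * pairAnnihilation a =
      (Fintype.card ι : A) - totalNumber c a := by
  have key : ∀ F x y : A, F * (x * y) - x * y * F = (F * x - x * F) * y + x * (F * y - y * F) := by
    intros; noncomm_ring
  rw [show (Fintype.card ι : A) = ∑ _i : ι, 1 by simp, totalNumber, ← Finset.sum_sub_distrib]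
  conv_lhs => rw [show pairCreation c = ∑ i, c (.inl i) * c (.inr i) from rfl]
  rw [Finset.sum_mul, Finset.mul_sum, ← Finset.sum_sub_distrib]
  refine Finset.sum_congr rfl fun i _ => ?_
  rw [key, h.pairAnnihilation_creation_inl, h.pairAnnihilation_creation_inr,
    h.annihilation_mul_creation]
  noncomm_ring

/-- Together with `pairCreation_pairNumber` this shows that E preserves the number of unpaired
labels, the total minus twice the pairs; the two lemmas for F do the same. -/
theorem pairCreation_totalNumber :
    totalNumber c a * pairCreation c - pairCreation c * totalNumber c a = 2 * pairCreation c := by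
  conv_rhs => rw [pairCreation]
  rw [totalNumber, Finset.sum_mul, Finset.mul_sum, Finset.mul_sum, ← Finset.sum_sub_distrib]
  refine Finset.sum_congr rfl fun i _ => ?_
  have e1 := h.pairCreation_annihilation_inl i
  have e2 := h.pairCreation_annihilation_inr i
  rw [sub_eq_iff_eq_add] at e1 e2
  rw [mul_add, ← mul_assoc, ← mul_assoc, h.pairCreation_comm_creation, h.pairCreation_comm_creation,
    mul_assoc, mul_assoc, e1, e2, mul_add, mul_add, h.creation_swap (.inr i) (.inl i)]
  noncomm_ring

theorem pairAnnihilation_totalNumber :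
    totalNumber c a * pairAnnihilation a - pairAnnihilation a * totalNumber c a =
      -(2 * pairAnnihilation a) := by
  conv_rhs => rw [pairAnnihilation]
  rw [totalNumber, Finset.sum_mul, Finset.mul_sum, Finset.mul_sum, ← Finset.sum_sub_distrib,
    ← Finset.sum_neg_distrib]
  refine Finset.sum_congr rfl fun i _ => ?_
  have e1 := h.pairAnnihilation_creation_inl i
  have e2 := h.pairAnnihilation_creation_inr i
  rw [sub_eq_iff_eq_add] at e1 e2
  rw [mul_add, ← mul_assoc (pairAnnihilation a),
    ← mul_assoc (pairAnnihilation a), e1, e2, add_mul, add_mul, add_mul, mul_assoc (c _), mul_assoc (c _),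
    ← h.pairAnnihilation_comm_annihilation, ← h.pairAnnihilation_comm_annihilation, neg_mul,
    h.annihilation_swap (.inl i) (.inr i)]
  noncomm_ring

/-- Moving E past c_l a_l c_r a_r leaves two defects. The one from a_l contains c_r c_r and
vanishes; the one from a_r is c_l a_l c_r c_l = -c_l c_r. -/
theorem pairCreation_pairNumber :
    pairNumber c a * pairCreation c - pairCreation c * pairNumber c a = pairCreation c := by
  conv_rhs => rw [pairCreation]
  rw [pairNumber, Finset.sum_mul, Finset.mul_sum, ← Finset.sum_sub_distrib]
  refine Finset.sum_congr rfl fun i _ => ?_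
  have e1 := h.pairCreation_annihilation_inl i
  have e2 := h.pairCreation_annihilation_inr i
  rw [sub_eq_iff_eq_add] at e1 e2
  have e3 : c (.inl i) * a (.inl i) * (c (.inr i) * c (.inl i)) = -(c (.inl i) * c (.inr i)) := by
    rw [mul_assoc, ← mul_assoc (a _), h.annihilation_mul_creation_of_ne (by simp), neg_mul,
      mul_assoc, h.annihilation_mul_creation, mul_sub, ← mul_assoc (c (.inr i)),
      h.creation_swap (.inr i)]
    simp only [neg_mul, mul_neg, mul_one, sub_neg_eq_add, mul_add]
    rw [← mul_assoc (c (.inl i)), ← mul_assoc (c (.inl i)), h.creation_self]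
    simp
  have e4 : pairCreation c * (c (.inl i) * a (.inl i) * (c (.inr i) * a (.inr i))) =
      c (.inl i) * (-c (.inr i) + a (.inl i) * pairCreation c) * (c (.inr i) * a (.inr i)) := by
    rw [← e1, ← mul_assoc (pairCreation c), ← mul_assoc (pairCreation c),
      h.pairCreation_comm_creation, mul_assoc (c _)]
  have e5 : pairCreation c * (c (.inr i) * a (.inr i)) =
      c (.inr i) * (c (.inl i) + a (.inr i) * pairCreation c) := by
    rw [← e2, ← mul_assoc, h.pairCreation_comm_creation, mul_assoc]
  have e6 : c (.inl i) * (-c (.inr i) + a (.inl i) * pairCreation c) * (c (.inr i) * a (.inr i)) =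
      -(c (.inl i) * (c (.inr i) * c (.inr i)) * a (.inr i)) +
        c (.inl i) * a (.inl i) * (pairCreation c * (c (.inr i) * a (.inr i))) := by
    noncomm_ring
  rw [e4, e6, e5, h.creation_self, mul_add, mul_add, e3]
  noncomm_ring

/-- Here the defect from c_l survives, as a_r a_l c_r a_r = a_r a_l, and the one from c_r contains
a_l a_l and vanishes. -/
theorem pairAnnihilation_pairNumber :
    pairNumber c a * pairAnnihilation a - pairAnnihilation a * pairNumber c a =
      -pairAnnihilation a := by
  conv_rhs => rw [pairAnnihilation]
  rw [pairNumber, Finset.sum_mul, Finset.mul_sum, ← Finset.sum_sub_distrib,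
    ← Finset.sum_neg_distrib]
  refine Finset.sum_congr rfl fun i _ => ?_
  have e1 := h.pairAnnihilation_creation_inl i
  have e2 := h.pairAnnihilation_creation_inr i
  rw [sub_eq_iff_eq_add] at e1 e2
  have e3 : a (.inr i) * a (.inl i) * (c (.inr i) * a (.inr i)) = a (.inr i) * a (.inl i) := by
    rw [mul_assoc, ← mul_assoc (a (.inl i)), h.annihilation_mul_creation_of_ne (by simp), neg_mul,
      mul_assoc, h.annihilation_swap (.inl i), mul_neg, mul_neg, mul_neg, neg_neg, ← mul_assoc, ← mul_assoc,
      h.annihilation_mul_creation, sub_mul, sub_mul, one_mul, mul_assoc (c _), h.annihilation_self]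
    simp
  have e4 : pairAnnihilation a * (c (.inl i) * a (.inl i) * (c (.inr i) * a (.inr i))) =
      a (.inr i) * a (.inl i) * (c (.inr i) * a (.inr i)) +
      c (.inl i) * a (.inl i) * (pairAnnihilation a * c (.inr i) * a (.inr i)) := by
    rw [← mul_assoc (pairAnnihilation a), ← mul_assoc (pairAnnihilation a), e1, add_mul, add_mul,
      mul_assoc (c _), h.pairAnnihilation_comm_annihilation]
    noncomm_ring
  have e5 : c (.inl i) * a (.inl i) * ((-a (.inl i) + c (.inr i) * pairAnnihilation a) * a (.inr i)) =
      -(c (.inl i) * (a (.inl i) * a (.inl i)) * a (.inr i)) +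
      c (.inl i) * a (.inl i) * c (.inr i) * (pairAnnihilation a * a (.inr i)) := by
    noncomm_ring
  rw [e4, e3, e2, e5, h.annihilation_self, h.pairAnnihilation_comm_annihilation]
  noncomm_ring

end IsFermion
end Fermion

/-! ### Multiplicities -/

section Counting

variable {ι : Type*} [Fintype ι] [DecidableEq ι]

/-- The number of `i` such that `S` contains both copies of `i`. -/
def pairCount (S : Finset (ι ⊕ ι)) : ℕ := (S.toLeft ∩ S.toRight).card

omit [Fintype ι] in
theorem card_eq_symmDiff_add (S : Finset (ι ⊕ ι)) :
    S.card = (symmDiff S.toLeft S.toRight).card + 2 * pairCount S := by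
  rw [← Finset.card_toLeft_add_card_toRight (u := S), pairCount, symmDiff, Finset.sup_eq_union,
    Finset.card_union_of_disjoint disjoint_sdiff_sdiff,
    ← Finset.card_inter_add_card_sdiff S.toLeft S.toRight,
    ← Finset.card_inter_add_card_sdiff S.toRight S.toLeft, Finset.inter_comm S.toRight]
  ring

/-- Such an S amounts to the set K of the k indices met once, the subset X of K where the left copy
is the one present, and the set M, disjoint from K, of the m complete pairs. -/
theorem card_filter_pairCount (k m : ℕ) :
    (Finset.univ.filter fun S : Finset (ι ⊕ ι) => S.card = k + 2 * m ∧ pairCount S = m).card =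
      2 ^ k * (Fintype.card ι).choose k * (Fintype.card ι - k).choose m := by
  have h : (Finset.univ.filter fun S : Finset (ι ⊕ ι) => S.card = k + 2 * m ∧ pairCount S = m).card =
      ((Finset.powersetCard k (Finset.univ : Finset ι)).sigma fun K =>
        K.powerset ×ˢ Finset.powersetCard m Kᶜ).card := by
    refine Finset.card_nbij'
      (fun S => ⟨symmDiff S.toLeft S.toRight, (S.toLeft \ S.toRight, S.toLeft ∩ S.toRight)⟩)
      (fun x => (x.2.1 ∪ x.2.2).disjSum (x.1 \ x.2.1 ∪ x.2.2)) ?_ ?_ ?_ ?_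
    · intro S hS
      simp only [Finset.coe_filter, Finset.mem_univ, true_and, Set.mem_ofPred_eq] at hS
      have h1 := card_eq_symmDiff_add S
      simp only [Finset.coe_sigma, Set.mem_sigma_iff, Finset.mem_coe, Finset.mem_powersetCard,
        Finset.mem_product, Finset.mem_powerset, Finset.subset_univ, true_and]
      refine ⟨by omega, ?_, ?_, hS.2⟩
      · intro i; simp [Finset.mem_symmDiff]; tauto
      · intro i; simp; tauto
    · rintro ⟨K, X, M⟩ hx
      simp only [Finset.coe_sigma, Set.mem_sigma_iff, Finset.mem_coe, Finset.mem_powersetCard,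
        Finset.mem_product, Finset.mem_powerset, Finset.subset_univ, true_and] at hx
      obtain ⟨hK, hX, hM, hm⟩ := hx
      have hp : pairCount ((X ∪ M).disjSum (K \ X ∪ M)) = m := by
        rw [pairCount, Finset.toLeft_disjSum, Finset.toRight_disjSum, ← hm]
        congr 1
        ext i
        have := @hX i
        have := @hM i
        simp at this ⊢
        tauto
      simp only [Finset.coe_filter, Finset.mem_univ, true_and, Set.mem_ofPred_eq]
      refine ⟨?_, hp⟩
      rw [card_eq_symmDiff_add, hp, ← hK, Finset.toLeft_disjSum, Finset.toRight_disjSum]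
      congr 2
      ext i
      have := @hX i
      have := @hM i
      simp [Finset.mem_symmDiff] at this ⊢
      tauto
    · intro S _
      ext i
      rcases i with i | i <;> simp [Finset.mem_symmDiff] <;> tauto
    · rintro ⟨K, X, M⟩ hx
      simp only [Finset.coe_sigma, Set.mem_sigma_iff, Finset.mem_coe, Finset.mem_powersetCard,
        Finset.mem_product, Finset.mem_powerset, Finset.subset_univ, true_and] at hx
      obtain ⟨hK, hX, hM, hm⟩ := hx
      have e1 : symmDiff (X ∪ M) (K \ X ∪ M) = K := by
        ext i
        have := @hX i
        have := @hM i
        simp [Finset.mem_symmDiff] at this ⊢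
        tauto
      have e2 : (X ∪ M) \ (K \ X ∪ M) = X := by
        ext i
        have := @hX i
        have := @hM i
        simp at this ⊢
        tauto
      have e3 : (X ∪ M) ∩ (K \ X ∪ M) = M := by
        ext i
        have := @hX i
        have := @hM i
        simp at this ⊢
        tauto
      simp [e1, e2, e3]
  rw [h, Finset.card_sigma, Finset.sum_congr rfl (g := fun _ => 2 ^ k * (Fintype.card ι - k).choose m)]
  · rw [Finset.sum_const, Finset.card_powersetCard, Finset.card_univ, smul_eq_mul]
    ring
  · intro K hK
    rw [Finset.mem_powersetCard] at hK
    rw [Finset.card_product, Finset.card_powerset, Finset.card_powersetCard, Finset.card_compl, hK.2]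

end Counting

namespace Heisenberg

theorem multiplicity_zero (n k : ℕ) : multiplicity n k 0 = 2 ^ k * (n.choose k : ℝ) := if_pos rfl

/-- The coefficient is the increment of the dimensions 2^k C(n,k) C(n-k,m). The identity is also
used beyond the middle, where the increment may be negative: the induction in `trace_aeval_mul_proj`
needs it there. -/
theorem multiplicity_succ {n k j : ℕ} (h : k + j + 1 ≤ n) : multiplicity n k (j + 1) =
    2 ^ k * (n.choose k : ℝ) * ((n - k).choose (j + 1) - (n - k).choose j) := by
  rw [multiplicity, if_neg j.succ_ne_zero]
  obtain ⟨r, rfl⟩ : ∃ r, n = k + (j + 1 + r) := ⟨n - k - j - 1, by omega⟩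
  have h1 : Nat.multinomial Finset.univ ![k, j + 1, k + (j + 1 + r) - k - (j + 1)] =
      (k + (j + 1 + r)).choose k * (j + 1 + r).choose (j + 1) := by
    rw [show k + (j + 1 + r) - k - (j + 1) = r by omega]
    have e0 := Nat.multinomial_spec Finset.univ ![k, j + 1, r]
    simp only [Fin.prod_univ_three, Fin.sum_univ_three, Matrix.cons_val] at e0
    have e1 := Nat.add_choose_mul_factorial_mul_factorial k (j + 1 + r)
    have e2 := Nat.add_choose_mul_factorial_mul_factorial (j + 1) r
    have hpos : 0 < k.factorial * (j + 1).factorial * r.factorial := by positivity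
    refine Nat.eq_of_mul_eq_mul_left hpos ?_
    rw [e0, add_assoc, ← e1, ← e2, ← Nat.choose_symm_add (a := k), ← Nat.choose_symm_add (a := j + 1)]
    ring
  have h2 : ((j + 1 + r).choose (j + 1) : ℝ) * (j + 1) = (j + 1 + r).choose j * (r + 1) := by
    have := Nat.choose_succ_right_eq (j + 1 + r) j
    rw [show j + 1 + r - j = r + 1 by omega] at this
    exact_mod_cast this
  rw [h1, show k + (j + 1 + r) - k = j + 1 + r by omega]
  have h3 : (r : ℝ) + 1 ≠ 0 := by positivity
  push_cast
  rw [show (k : ℝ) + (j + 1 + r) - k - (j + 1) + 1 = r + 1 by ring,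
    show (k : ℝ) + (j + 1 + r) - k - 2 * (j + 1) + 1 = r - j by ring]
  field_simp
  linear_combination (-1 : ℝ) * ((k + (j + 1 + r)).choose k : ℝ) * h2

/-- Strict positivity is what lets `isRoot_minpoly` conclude from a vanishing weighted sum of
squares that each square vanishes. -/
theorem multiplicity_pos {n k j : ℕ} (h : k + 2 * j ≤ n) : 0 < multiplicity n k j := by
  have hk : (0 : ℝ) < n.choose k := by exact_mod_cast Nat.choose_pos (by omega)
  rw [multiplicity]
  split_ifs
  · positivity
  · have h1 : (k : ℝ) + 2 * j ≤ n := by exact_mod_cast h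
    have h2 : (0 : ℝ) ≤ j := by positivity
    have h3 : (0 : ℝ) < Nat.multinomial Finset.univ ![k, j, n - k - j] := by
      exact_mod_cast Nat.multinomial_pos _ _
    exact mul_pos (mul_pos (by positivity) h3) (div_pos (by linarith) (by linarith))

end Heisenberg

/-! ### Monomials -/

section Monomials

theorem repr_apply_of_diagonal {V I : Type*} [AddCommGroup V] [Module ℝ V] (E : Basis I ℝ V)
    {D : End ℝ V} {l : I → ℝ} (h : ∀ S, D (E S) = l S • E S) (v : V) (T : I) :
    E.repr (D v) T = l T * E.repr v T := by
  have : E.coord T ∘ₗ D = l T • E.coord T := by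
    refine E.ext fun S => ?_
    rw [LinearMap.comp_apply, h, map_smul, LinearMap.smul_apply]
    by_cases hS : S = T
    · rw [hS]
    · simp [hS]
  exact LinearMap.congr_fun this v

variable {L : Type*} [LieRing L] [LieAlgebra ℝ L] {I : Type*}

theorem wedge_mul_wedge_add (φ ψ : Dual ℝ L) (a : CE L) :
    ExteriorAlgebra.ι ℝ φ * (ExteriorAlgebra.ι ℝ ψ * a) +
      ExteriorAlgebra.ι ℝ ψ * (ExteriorAlgebra.ι ℝ φ * a) = 0 := by
  rw [← mul_assoc, ← mul_assoc, ← add_mul, ExteriorAlgebra.ι_add_mul_swap, zero_mul]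

/-- e^p ∧ ι_p is an even derivation, so it counts the factors equal to e^p. -/
theorem wedge_contr_ιMulti [DecidableEq I] (b : Basis I ℝ L) (p : I) {k : ℕ} (v : Fin k → I) :
    ExteriorAlgebra.ι ℝ (b.coord p) * contr (b p) (ExteriorAlgebra.ιMulti ℝ k (b.coord ∘ v)) =
      (∑ i, if v i = p then (1 : ℝ) else 0) • ExteriorAlgebra.ιMulti ℝ k (b.coord ∘ v) := by
  induction k with
  | zero => simp [contr_one]
  | succ k ih =>
    have h1 : Matrix.vecTail (b.coord ∘ v) = b.coord ∘ (v ∘ Fin.succ) := rfl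
    rw [ExteriorAlgebra.ιMulti_succ_apply, contr_ι_mul, h1, mul_sub, mul_smul_comm,
      eq_neg_of_add_eq_zero_left (wedge_mul_wedge_add (b.coord p) _ _), sub_neg_eq_add, ih,
      Fin.sum_univ_succ, add_smul, mul_smul_comm]
    congr 1
    rw [Function.comp_apply, Basis.coord_apply, Basis.repr_self]
    by_cases h : v 0 = p
    · simp [h]
    · simp [h]

theorem degPow_ιMulti (t : ℝ) {k : ℕ} (ψ : Fin k → Dual ℝ L) :
    degPow L t (ExteriorAlgebra.ιMulti ℝ k ψ) = t ^ k • ExteriorAlgebra.ιMulti ℝ k ψ :=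
  degPow_apply t (ExteriorAlgebra.ιMulti_range ℝ k ⟨ψ, rfl⟩)

theorem ιMulti_mem_basicCE [FiniteDimensional ℝ L] {k : ℕ} {ψ : Fin k → Dual ℝ L}
    (h : ∀ i, ψ i ∈ H1 L) : ExteriorAlgebra.ιMulti ℝ k ψ ∈ basicCE L := by
  rw [ExteriorAlgebra.ιMulti_apply]
  refine list_prod_mem fun x hx => ?_
  rw [List.mem_ofFn] at hx
  obtain ⟨i, rfl⟩ := hx
  exact MetricPair.ι_mem_basicCE (h i)

/-- The monomials in the linear forms dual to a basis `b` of `L`. -/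
theorem exists_monomial_basis [FiniteDimensional ℝ L] [Finite I] (b : Basis I ℝ L) :
    ∃ E : Basis (Finset I) ℝ (CE L), ∀ S,
      (∀ p ∈ S, ExteriorAlgebra.ι ℝ (b.coord p) * contr (b p) (E S) = E S) ∧
      (∀ p ∉ S, ExteriorAlgebra.ι ℝ (b.coord p) * contr (b p) (E S) = 0) ∧
      (∀ t, degPow L t (E S) = t ^ S.card • E S) ∧
      ((∀ p ∈ S, b.coord p ∈ H1 L) → E S ∈ basicCE L) := by
  classical
  have _ : Fintype I := Fintype.ofFinite I
  -- The basis of the exterior algebra requires an ordered index type. Any order will do: it only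
  -- affects signs of monomials, and the eigenvalue equations do not see these.
  let _ : LinearOrder I := LinearOrder.lift' (Fintype.equivFin I) (Fintype.equivFin I).injective
  refine ⟨b.dualBasis.ExteriorAlgebra, fun S => ?_⟩
  set w := Set.powersetCard.ofFinEmbEquiv.symm (Set.powersetCard.ofCard (rfl : S.card = S.card))
  have hw : ∀ p, (∃ i, w i = p) ↔ p ∈ S := fun p =>
    Set.powersetCard.mem_range_ofFinEmbEquiv_symm_iff_mem _ p
  have hE : b.dualBasis.ExteriorAlgebra S = ExteriorAlgebra.ιMulti ℝ S.card (b.coord ∘ w) := by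
    rw [ExteriorAlgebra.basis_apply_ofCard b.dualBasis rfl, ExteriorAlgebra.ιMulti_family,
      b.coe_dualBasis]
  rw [hE]
  refine ⟨fun p hp => ?_, fun p hp => ?_, fun t => degPow_ιMulti t _, fun h => ?_⟩
  · obtain ⟨i, rfl⟩ := (hw p).2 hp
    rw [wedge_contr_ιMulti]
    simp
  · rw [wedge_contr_ιMulti, Finset.sum_eq_zero, zero_smul]
    intro i _
    exact if_neg fun hi => hp ((hw p).1 ⟨i, hi⟩)
  · exact ιMulti_mem_basicCE fun i => h _ ((hw _).1 ⟨i, rfl⟩)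

end Monomials

namespace Heisenberg

variable {n : ℕ}

/-! ### Creation and annihilation operators on basic forms -/

variable (n) in
/-- The space of basic forms on the Heisenberg Lie algebra. -/
abbrev BasicForms : Submodule ℝ (CE (Heisenberg n)) :=
  Subalgebra.toSubmodule (basicCE (Heisenberg n))

/-- The inclusion of the labels of the noncentral basis vectors. -/
def label : Fin n ⊕ Fin n ↪ Fin n ⊕ Fin n ⊕ Unit where
  toFun := Sum.map id Sum.inl
  inj' := Sum.map_injective.2 ⟨Function.injective_id, Sum.inl_injective⟩

theorem label_ne (q : Fin n ⊕ Fin n) : label q ≠ .inr (.inr ()) := by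
  rcases q with i | i <;> simp [label]

theorem exists_label {p : Fin n ⊕ Fin n ⊕ Unit} (hp : p ≠ .inr (.inr ())) :
    ∃ q, label q = p := by
  rcases p with i | i | i
  · exact ⟨.inl i, rfl⟩
  · exact ⟨.inr i, rfl⟩
  · exact absurd rfl hp

theorem coord_z (p : Fin n ⊕ Fin n ⊕ Unit) (hp : p ≠ .inr (.inr ())) :
    (basis n).coord p z = 0 := by
  rw [z, Basis.coord_apply, Basis.repr_self, Finsupp.single_eq_of_ne hp]

theorem coord_mem_H1 (q : Fin n ⊕ Fin n) : (basis n).coord (label q) ∈ H1 (Heisenberg n) := by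
  rw [mem_H1_iff]
  intro x y
  rw [lie_def, map_smul, coord_z _ (label_ne q), smul_zero]

/-- This is where n ≥ 1 matters: z is a bracket. For n = 0 the form z^* itself would be closed. -/
theorem apply_z_of_mem_H1 (hn : 1 ≤ n) {φ : Dual ℝ (Heisenberg n)} (h : φ ∈ H1 (Heisenberg n)) :
    φ z = 0 := by
  have := (mem_H1_iff φ).1 h (y ⟨0, hn⟩) (y' ⟨0, hn⟩)
  rwa [lie_y_y', if_pos rfl] at this

theorem contr_z_of_mem (hn : 1 ≤ n) {a : CE (Heisenberg n)} (ha : a ∈ basicCE (Heisenberg n)) :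
    contr z a = 0 := by
  refine MetricPair.basicCE_induction (C := fun a => contr z a = 0) ?_ ?_ ?_ ?_ ha
  · exact contr_one _
  · intro a b ha hb; rw [map_add, ha, hb, add_zero]
  · intro r a ha; rw [map_smul, ha, smul_zero]
  · intro φ hφ a _ ha
    rw [contr_ι_mul, ha, apply_z_of_mem_H1 hn hφ, zero_smul, mul_zero, sub_zero]

/-- Left multiplication of basic forms with the linear form dual to a noncentral basis vector. -/
def creation (q : Fin n ⊕ Fin n) : End ℝ (BasicForms n) :=
  (wedge _ ((basis n).coord (label q))).restrict fun _ ha =>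
    (basicCE _).mul_mem (MetricPair.ι_mem_basicCE (coord_mem_H1 q)) ha

/-- Contraction of basic forms with a noncentral basis vector. -/
def annihilation (q : Fin n ⊕ Fin n) : End ℝ (BasicForms n) :=
  (contr (basis n (label q))).restrict fun _ ha => MetricPair.contr_mem_basicCE _ ha

theorem isFermion : IsFermion (creation (n := n)) annihilation where
  creation p q := by
    ext a
    exact wedge_mul_wedge_add _ _ _
  creation_self p := by
    ext a
    change ExteriorAlgebra.ι ℝ _ * (ExteriorAlgebra.ι ℝ _ * (a : CE (Heisenberg n))) = 0
    rw [← mul_assoc, ExteriorAlgebra.ι_sq_zero, zero_mul]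
  annihilation p q := by
    ext a
    change contr _ (contr _ (a : CE (Heisenberg n))) + contr _ (contr _ (a : CE (Heisenberg n))) = 0
    rw [← eq_neg_iff_add_eq_zero]
    exact CliffordAlgebra.contractLeft_comm _ _ _
  annihilation_self p := by
    ext a
    exact contr_contr_self _ _
  mixed p q := by
    ext a
    change contr _ (ExteriorAlgebra.ι ℝ _ * (a : CE (Heisenberg n))) +
      ExteriorAlgebra.ι ℝ _ * contr _ (a : CE (Heisenberg n)) = _
    rw [contr_ι_mul, sub_add_cancel, Basis.coord_apply, Basis.repr_self]
    split_ifs with h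
    · simp [h]
    · rw [Finsupp.single_eq_of_ne (fun h' => h (label.injective h'.symm))]
      simp

/-! ### The basic Laplacian -/

variable (n) in
/-- The symplectic form `d z^*`. -/
def symplecticForm : CE (Heisenberg n) :=
  ∑ i, ExteriorAlgebra.ι ℝ ((basis n).coord (label (.inl i))) *
    ExteriorAlgebra.ι ℝ ((basis n).coord (label (.inr i)))

/-- Brackets are multiples of z, so the coefficients of dφ are φ(z) times those of the symplectic
form. Summing over `finBasis` reassembles the coordinate forms of the standard basis, and the two
antisymmetric halves absorb the factor 1/2. -/
theorem ceDiff_ι_eq (φ : Dual ℝ (Heisenberg n)) :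
    ceDiff (Heisenberg n) (ExteriorAlgebra.ι ℝ φ) = φ z • symplecticForm n := by
  have key : ∀ α β : Dual ℝ (Heisenberg n), ∑ i, α (finBasis ℝ (Heisenberg n) i) •
      ∑ j, β (finBasis ℝ (Heisenberg n) j) •
      (ExteriorAlgebra.ι ℝ ((finBasis ℝ (Heisenberg n)).coord i) *
        ExteriorAlgebra.ι ℝ ((finBasis ℝ (Heisenberg n)).coord j)) =
      ExteriorAlgebra.ι ℝ α * ExteriorAlgebra.ι ℝ β := fun α β => by
    conv_rhs => rw [← MetricPair.sum_smul_coord α, ← MetricPair.sum_smul_coord β]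
    rw [map_sum, map_sum, Finset.sum_mul]
    refine Finset.sum_congr rfl fun i _ => ?_
    rw [map_smul, smul_mul_assoc, Finset.mul_sum]
    congr 1
    refine Finset.sum_congr rfl fun j _ => ?_
    rw [map_smul, mul_smul_comm]
  have h1 : ∀ v w : Heisenberg n, φ ⁅v, w⁆ = ∑ q : Fin n, φ z *
      ((basis n).coord (label (.inl q)) v * (basis n).coord (label (.inr q)) w -
      (basis n).coord (label (.inr q)) v * (basis n).coord (label (.inl q)) w) := fun v w => by
    rw [lie_def, map_smul, omega, smul_eq_mul, mul_comm, Finset.mul_sum]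
    rfl
  rw [ceDiff_ι]
  simp only [h1, Finset.sum_smul]
  rw [Finset.sum_congr rfl fun i _ => Finset.sum_comm, Finset.sum_comm, Finset.smul_sum,
    symplecticForm, Finset.smul_sum]
  refine Finset.sum_congr rfl fun q _ => ?_
  simp only [mul_smul, sub_smul, ← Finset.smul_sum, Finset.sum_sub_distrib]
  rw [key, key, eq_neg_of_add_eq_zero_left (ExteriorAlgebra.ι_add_mul_swap
    ((basis n).coord (label (.inr q))) ((basis n).coord (label (.inl q))))]
  module

theorem symplecticForm_mul (a : CE (Heisenberg n)) : symplecticForm n * a =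
    ∑ i, ExteriorAlgebra.ι ℝ ((basis n).coord (label (.inl i))) *
      (ExteriorAlgebra.ι ℝ ((basis n).coord (label (.inr i))) * a) := by
  simp [symplecticForm, Finset.sum_mul, mul_assoc]

/-- Both sides are odd derivations, since the symplectic form is even and hence central, and they
agree on linear forms. -/
theorem ceDiff_eq (a : CE (Heisenberg n)) :
    ceDiff (Heisenberg n) a = symplecticForm n * contr z a := by
  induction a using ce_induction with
  | one => rw [ceDiff_one, contr_one, mul_zero]
  | add a b ha hb => rw [map_add, ha, hb, map_add, mul_add]
  | smul r a ha => rw [map_smul, ha, map_smul, mul_smul_comm]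
  | ι_mul φ a ha =>
    rw [ceDiff_ι_mul, ha, contr_ι_mul, ceDiff_ι_eq, mul_sub, smul_mul_assoc, mul_smul_comm]
    congr 1
    rw [symplecticForm_mul, symplecticForm_mul, Finset.mul_sum]
    refine Finset.sum_congr rfl fun i _ => ?_
    rw [← neg_inj, ← neg_inj]
    rw [eq_neg_of_add_eq_zero_left (wedge_mul_wedge_add φ _ _),
      eq_neg_of_add_eq_zero_left (wedge_mul_wedge_add φ _ _), mul_neg, neg_neg]

theorem form_basis (p : Fin n ⊕ Fin n ⊕ Unit) :
    (metricPair n).form (basis n p) = (basis n).coord p := by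
  refine (basis n).ext fun q => ?_
  rw [metricPair_orthonormal, Basis.coord_apply, Basis.repr_self, Finsupp.single_apply]
  simp [eq_comm]

theorem sharp_coord (p : Fin n ⊕ Fin n ⊕ Unit) :
    (metricPair n).sharp ((basis n).coord p) = basis n p := by
  rw [← form_basis, MetricPair.sharp_form]

/-- Take adjoints in `ceDiff_eq`: orthonormality makes multiplication by e^p and contraction with
e_p adjoint, and the order of the factors is reversed. -/
theorem ceCodiff_eq (a : CE (Heisenberg n)) : (metricPair n).ceCodiff a =
    ExteriorAlgebra.ι ℝ ((basis n).coord (.inr (.inr ()))) *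
      ∑ i, contr (basis n (label (.inr i))) (contr (basis n (label (.inl i))) a) := by
  refine (metricPair n).innerCE_ext fun b => ?_
  rw [MetricPair.innerCE_ceCodiff, MetricPair.innerCE_ι_mul, sharp_coord, ceDiff_eq,
    symplecticForm_mul, LinearMap.BilinForm.sum_left, LinearMap.BilinForm.sum_right]
  refine Finset.sum_congr rfl fun i _ => ?_
  rw [MetricPair.innerCE_ι_mul_right, MetricPair.innerCE_ι_mul_right, sharp_coord, sharp_coord]
  rfl

/-- On a basic form a the term d^* d drops out, and d d^* a = ω ∧ ι_z (z^* ∧ w) = ω ∧ w with w = F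
a, because w is basic and so ι_z w = 0. -/
theorem basicLaplacian_eq (hn : 1 ≤ n) : (metricPair n).basicLaplacian =
    pairCreation creation * pairAnnihilation annihilation := by
  ext a
  set w : BasicForms n := pairAnnihilation annihilation a with hw
  have h1 : (metricPair n).ceCodiff a =
      ExteriorAlgebra.ι ℝ ((basis n).coord (.inr (.inr ()))) * (w : CE (Heisenberg n)) := by
    rw [ceCodiff_eq, hw, pairAnnihilation, LinearMap.sum_apply, Submodule.coe_sum]
    rfl
  have h2 : ((pairCreation creation w : BasicForms n) : CE (Heisenberg n)) =
      symplecticForm n * (w : CE (Heisenberg n)) := by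
    rw [symplecticForm_mul, pairCreation, LinearMap.sum_apply, Submodule.coe_sum]
    rfl
  change ceDiff _ ((metricPair n).ceCodiff a) + (metricPair n).ceCodiff (ceDiff _ a) =
    ((pairCreation creation w : BasicForms n) : CE (Heisenberg n))
  rw [MetricPair.ceDiff_eq_zero_of_mem a.2, map_zero, add_zero, h1, h2, ceDiff_eq, contr_ι_mul,
    contr_z_of_mem hn w.2, mul_zero, sub_zero, z, Basis.coord_apply, Basis.repr_self]
  simp

/-! ### The monomial basis of basic forms -/

/-- Only the eigenvalues of the number operators and of the degree operator are recorded. The signs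
in the action of a single creation or annihilation operator on monomials are never needed. -/
theorem exists_basicForms_basis (hn : 1 ≤ n) : ∃ B : Basis (Finset (Fin n ⊕ Fin n)) ℝ (BasicForms n),
    (∀ S q, creation q (annihilation q (B S)) = (if q ∈ S then (1 : ℝ) else 0) • B S) ∧
    ∀ S t, degPow (Heisenberg n) t (B S) = t ^ S.card • (B S : CE (Heisenberg n)) := by
  classical
  obtain ⟨E, hE⟩ := exists_monomial_basis (basis n)
  have hmem : ∀ S : Finset (Fin n ⊕ Fin n), E (S.map label) ∈ BasicForms n := fun S => by
    refine (hE _).2.2.2 fun p hp => ?_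
    obtain ⟨q, -, rfl⟩ := Finset.mem_map.1 hp
    exact coord_mem_H1 q
  let f : Finset (Fin n ⊕ Fin n) → BasicForms n := fun S => ⟨E (S.map label), hmem S⟩
  have hli : LinearIndependent ℝ f :=
    .of_comp (BasicForms n).subtype (E.linearIndependent.comp _ (Finset.map_injective label))
  have hspan : ⊤ ≤ Submodule.span ℝ (Set.range f) := by
    intro a _
    -- The operator z^* ∧ ι_z kills the basic form a, but acts as 1 on every monomial containing
    -- z^*.
    have h0 : ∀ T : Finset _, Sum.inr (Sum.inr ()) ∈ T → E.repr (a : CE (Heisenberg n)) T = 0 := by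
      intro T hT
      have hd : ∀ S, (wedge _ ((basis n).coord (.inr (.inr ()))) *
          contr (basis n (.inr (.inr ())))) (E S) =
            (if Sum.inr (Sum.inr ()) ∈ S then (1 : ℝ) else 0) • E S := fun S => by
        split_ifs with h
        · rw [one_smul]; exact (hE S).1 _ h
        · rw [zero_smul]; exact (hE S).2.1 _ h
      have := repr_apply_of_diagonal E hd a T
      rw [if_pos hT, one_mul] at this
      rw [← this, Module.End.mul_apply, show contr (basis n (.inr (.inr ()))) (a : CE (Heisenberg n)) = 0
        from contr_z_of_mem hn a.2]
      simp
    have ha : a = ∑ S : Finset (Fin n ⊕ Fin n),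
        E.repr (a : CE (Heisenberg n)) (S.map label) • f S := by
      apply Subtype.ext
      rw [Submodule.coe_sum]
      conv_lhs => rw [← E.sum_repr (a : CE (Heisenberg n))]
      symm
      refine Finset.sum_of_injOn (fun S => S.map label) (Finset.map_injective label).injOn
        (by simp) ?_ (fun _ _ => rfl)
      intro T _ hT
      rw [h0, zero_smul]
      by_contra hz
      refine hT ⟨Finset.univ.filter fun q => label q ∈ T, by simp, ?_⟩
      ext p
      simp only [Finset.mem_map, Finset.mem_filter, Finset.mem_univ, true_and]
      constructor
      · rintro ⟨q, hq, rfl⟩; exact hq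
      · intro hp
        obtain ⟨q, rfl⟩ := exists_label (p := p) (fun h => hz (h ▸ hp))
        exact ⟨q, hp, rfl⟩
    rw [ha]
    exact sum_mem fun S _ => Submodule.smul_mem _ _ (Submodule.subset_span ⟨S, rfl⟩)
  refine ⟨Basis.mk hli hspan, fun S q => ?_, fun S t => ?_⟩
  · rw [Basis.mk_apply]
    apply Subtype.ext
    split_ifs with h
    · rw [one_smul]
      exact (hE _).1 _ (Finset.mem_map_of_mem label h)
    · rw [zero_smul]
      exact (hE _).2.1 _ (by simpa using h)
  · rw [Basis.mk_apply, ← Finset.card_map label]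
    exact (hE _).2.2.1 t

end Heisenberg

/-! ### Sectors of fixed pair number and the trace of the Laplacian on them -/

theorem aeval_minpoly_sq {V : Type*} [AddCommGroup V] [Module ℝ V] (T : End ℝ V) :
    Polynomial.aeval T (minpoly ℝ T ^ 2) = 0 := by
  rw [map_pow, minpoly.aeval, zero_pow two_ne_zero]

namespace Heisenberg

variable {n : ℕ}

/-- The left side counts the indices i met by S. It gives k + m ≤ n, so the ranges k ≤ n and m ≤ n -
k reach every monomial. -/
theorem card_sub_pairCount_le (S : Finset (Fin n ⊕ Fin n)) : S.card - pairCount S ≤ n := by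
  rw [card_eq_symmDiff_add]
  have h : (symmDiff S.toLeft S.toRight).card + pairCount S ≤ n := by
    rw [pairCount, ← Finset.card_union_of_disjoint]
    · exact (Finset.card_le_univ _).trans (Fintype.card_fin n).le
    · rw [Finset.disjoint_left]
      intro i
      simp [Finset.mem_symmDiff]
      tauto
  omega

section Projections

variable (B : Basis (Finset (Fin n ⊕ Fin n)) ℝ (BasicForms n))

/-- The projection onto the span of the monomials that contain `m` of the pairs
`{y_i, y_{i+n}}` and exactly one element of `k` of them. -/
def proj (k m : ℕ) : End ℝ (BasicForms n) :=
  B.constr ℝ fun S => if S.card = k + 2 * m ∧ pairCount S = m then B S else 0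

theorem proj_basis (k m : ℕ) (S : Finset (Fin n ⊕ Fin n)) :
    proj B k m (B S) = if S.card = k + 2 * m ∧ pairCount S = m then B S else 0 :=
  B.constr_basis ℝ _ S

theorem trace_proj (k m : ℕ) : LinearMap.trace ℝ (BasicForms n) (proj B k m) =
    2 ^ k * (n.choose k : ℝ) * (n - k).choose m := by
  have h := card_filter_pairCount (ι := Fin n) k m
  rw [Fintype.card_fin] at h
  rw [LinearMap.trace_eq_matrix_trace ℝ B, Matrix.trace]
  have : ∀ S, (LinearMap.toMatrix B B (proj B k m)).diag S =
      if S.card = k + 2 * m ∧ pairCount S = m then 1 else 0 := fun S => by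
    rw [Matrix.diag_apply, LinearMap.toMatrix_apply, proj_basis]
    split_ifs <;> simp
  rw [Finset.sum_congr rfl fun S _ => this S, Finset.sum_boole, h]
  push_cast
  rfl

/-- Each monomial lies in exactly one sector (k, m), and its degree is 2m + k. -/
theorem degPow_restrict_eq
    (hB : ∀ S t, degPow (Heisenberg n) t (B S) = t ^ S.card • (B S : CE (Heisenberg n))) (t : ℝ) :
    (degPow (Heisenberg n) t).restrict (fun _ ha => degPow_mem_basicCE t ha) =
      ∑ k ∈ Finset.range (n + 1), ∑ m ∈ Finset.range (n - k + 1),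
        t ^ (2 * m + k) • proj B k m := by
  refine B.ext fun S => ?_
  have h0 := card_sub_pairCount_le S
  have h1 := card_eq_symmDiff_add S
  have h2 : (degPow (Heisenberg n) t).restrict (fun _ ha => degPow_mem_basicCE t ha) (B S) =
      t ^ S.card • B S := Subtype.ext (hB S t)
  rw [h2, LinearMap.sum_apply, Finset.sum_eq_single (S.card - 2 * pairCount S),
    LinearMap.sum_apply, Finset.sum_eq_single (pairCount S), LinearMap.smul_apply, proj_basis,
    if_pos ⟨by omega, rfl⟩]
  · congr 2
    omega
  · intro m _ hm
    rw [LinearMap.smul_apply, proj_basis, if_neg fun h => hm h.2.symm, smul_zero]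
  · intro h
    rw [Finset.mem_range] at h
    omega
  · intro k _ hk
    rw [LinearMap.sum_apply]
    refine Finset.sum_eq_zero fun m _ => ?_
    rw [LinearMap.smul_apply, proj_basis, if_neg, smul_zero]
    rintro ⟨h3, h4⟩
    omega
  · intro h
    rw [Finset.mem_range] at h
    omega

variable {B}
variable (hB : ∀ S q, creation q (annihilation q (B S)) = (if q ∈ S then (1 : ℝ) else 0) • B S)
include hB

theorem totalNumber_basis (S : Finset (Fin n ⊕ Fin n)) :
    totalNumber creation annihilation (B S) = (S.card : ℝ) • B S := by
  rw [totalNumber, LinearMap.sum_apply]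
  simp only [LinearMap.add_apply, Module.End.mul_apply, hB]
  rw [Finset.sum_add_distrib, ← Finset.sum_smul, ← Finset.sum_smul, ← add_smul, Finset.sum_boole,
    Finset.sum_boole, ← Finset.card_toLeft_add_card_toRight (u := S), Nat.cast_add]
  congr 4 <;> ext i <;> simp

theorem pairNumber_basis (S : Finset (Fin n ⊕ Fin n)) :
    pairNumber creation annihilation (B S) = (pairCount S : ℝ) • B S := by
  rw [pairNumber, LinearMap.sum_apply]
  simp only [Module.End.mul_apply, hB, map_smul, smul_smul, ← ite_and, mul_ite, mul_one, mul_zero]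
  rw [← Finset.sum_smul, Finset.sum_boole, pairCount]
  congr 3
  ext i
  simp

/-- Joint eigenvectors of the number operators are joint eigenvectors of the projections. -/
theorem proj_apply {v : BasicForms n} {d e : ℝ} (hd : totalNumber creation annihilation v = d • v)
    (he : pairNumber creation annihilation v = e • v) (k m : ℕ) :
    proj B k m v = if d = k + 2 * m ∧ e = m then v else 0 := by
  refine B.repr.injective (Finsupp.ext fun T => ?_)
  have h1 := repr_apply_of_diagonal B (totalNumber_basis hB) v T
  have h2 := repr_apply_of_diagonal B (pairNumber_basis hB) v T
  rw [hd, map_smul, Finsupp.smul_apply, smul_eq_mul] at h1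
  rw [he, map_smul, Finsupp.smul_apply, smul_eq_mul] at h2
  have h3 : ∀ S, proj B k m (B S) =
      (if S.card = k + 2 * m ∧ pairCount S = m then (1 : ℝ) else 0) • B S := fun S => by
    rw [proj_basis]
    split_ifs <;> simp
  rw [repr_apply_of_diagonal B h3]
  by_cases h0 : B.repr v T = 0
  · split_ifs <;> simp [h0]
  rw [mul_right_cancel₀ h0 h1, mul_right_cancel₀ h0 h2]
  norm_cast
  split_ifs <;> simp

/-- Eigenvalues of `pairNumber` are cardinalities. Hence F kills the level m = 0, where it would
produce the eigenvalue -1. -/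
theorem eq_zero_of_pairNumber_neg {v : BasicForms n} {e : ℝ}
    (he : pairNumber creation annihilation v = e • v) (h : e < 0) : v = 0 := by
  refine B.repr.injective (Finsupp.ext fun T => ?_)
  have h2 := repr_apply_of_diagonal B (pairNumber_basis hB) v T
  rw [he, map_smul, Finsupp.smul_apply, smul_eq_mul] at h2
  by_contra h0
  have := mul_right_cancel₀ (show B.repr v T ≠ 0 by simpa using h0) h2
  have : (0 : ℝ) ≤ pairCount T := by positivity
  linarith

theorem totalNumber_pairCreation_basis (S : Finset (Fin n ⊕ Fin n)) :
    totalNumber creation annihilation (pairCreation creation (B S)) =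
      ((S.card : ℝ) + 2) • pairCreation creation (B S) := by
  have h := LinearMap.congr_fun (isFermion (n := n)).pairCreation_totalNumber (B S)
  rw [LinearMap.sub_apply, Module.End.mul_apply, Module.End.mul_apply, totalNumber_basis hB,
    map_smul, sub_eq_iff_eq_add, two_mul, LinearMap.add_apply] at h
  rw [h]
  module

theorem totalNumber_pairAnnihilation_basis (S : Finset (Fin n ⊕ Fin n)) :
    totalNumber creation annihilation (pairAnnihilation annihilation (B S)) =
      ((S.card : ℝ) - 2) • pairAnnihilation annihilation (B S) := by
  have h := LinearMap.congr_fun (isFermion (n := n)).pairAnnihilation_totalNumber (B S)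
  rw [LinearMap.sub_apply, Module.End.mul_apply, Module.End.mul_apply, totalNumber_basis hB,
    map_smul, sub_eq_iff_eq_add, two_mul, LinearMap.neg_apply, LinearMap.add_apply] at h
  rw [h]
  module

theorem pairNumber_pairCreation_basis (S : Finset (Fin n ⊕ Fin n)) :
    pairNumber creation annihilation (pairCreation creation (B S)) =
      ((pairCount S : ℝ) + 1) • pairCreation creation (B S) := by
  have h := LinearMap.congr_fun (isFermion (n := n)).pairCreation_pairNumber (B S)
  rw [LinearMap.sub_apply, Module.End.mul_apply, Module.End.mul_apply, pairNumber_basis hB,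
    map_smul, sub_eq_iff_eq_add] at h
  rw [h]
  module

theorem pairNumber_pairAnnihilation_basis (S : Finset (Fin n ⊕ Fin n)) :
    pairNumber creation annihilation (pairAnnihilation annihilation (B S)) =
      ((pairCount S : ℝ) - 1) • pairAnnihilation annihilation (B S) := by
  have h := LinearMap.congr_fun (isFermion (n := n)).pairAnnihilation_pairNumber (B S)
  rw [LinearMap.sub_apply, Module.End.mul_apply, Module.End.mul_apply, pairNumber_basis hB,
    map_smul, sub_eq_iff_eq_add, LinearMap.neg_apply] at h
  rw [h]
  module

/-- By the commutators with the number operators, E maps a monomial to a joint eigenvector with both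
eigenvalues known. This decides which projection fixes the image, without expanding it in monomials.
-/
theorem pairCreation_mul_proj (k m : ℕ) :
    pairCreation creation * proj B k m = proj B k (m + 1) * pairCreation creation := by
  refine B.ext fun S => ?_
  rw [Module.End.mul_apply, Module.End.mul_apply, proj_apply hB
    (totalNumber_pairCreation_basis hB S) (pairNumber_pairCreation_basis hB S), proj_basis]
  have hiff : (S.card : ℝ) + 2 = k + 2 * ((m + 1 : ℕ) : ℝ) ∧ (pairCount S : ℝ) + 1 = (m + 1 : ℕ) ↔
      S.card = k + 2 * m ∧ pairCount S = m := by
    norm_cast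
    omega
  simp only [hiff]
  split_ifs
  · rfl
  · exact map_zero _

theorem pairAnnihilation_mul_proj (k m : ℕ) :
    pairAnnihilation annihilation * proj B k (m + 1) =
      proj B k m * pairAnnihilation annihilation := by
  refine B.ext fun S => ?_
  rw [Module.End.mul_apply, Module.End.mul_apply, proj_apply hB
    (totalNumber_pairAnnihilation_basis hB S) (pairNumber_pairAnnihilation_basis hB S), proj_basis]
  have hiff : (S.card : ℝ) - 2 = k + 2 * (m : ℝ) ∧ (pairCount S : ℝ) - 1 = m ↔
      S.card = k + 2 * (m + 1) ∧ pairCount S = m + 1 := by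
    rw [sub_eq_iff_eq_add, sub_eq_iff_eq_add]
    norm_cast
  simp only [hiff]
  split_ifs
  · rfl
  · exact map_zero _

theorem pairAnnihilation_mul_proj_zero (k : ℕ) :
    pairAnnihilation annihilation * proj B k 0 = 0 := by
  refine B.ext fun S => ?_
  rw [Module.End.mul_apply, proj_basis, LinearMap.zero_apply]
  split_ifs with h
  · refine eq_zero_of_pairNumber_neg hB (pairNumber_pairAnnihilation_basis hB S) ?_
    rw [h.2]
    norm_num
  · exact map_zero _

theorem commutator_mul_proj {k : ℕ} (hk : k ≤ n) (m : ℕ) :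
    (pairAnnihilation annihilation * pairCreation creation -
      pairCreation creation * pairAnnihilation annihilation) * proj B k m =
      (((n - k : ℕ) : ℝ) - 2 * m) • proj B k m := by
  rw [isFermion.pairAnnihilation_pairCreation]
  refine B.ext fun S => ?_
  rw [Module.End.mul_apply, LinearMap.smul_apply, proj_basis]
  split_ifs with h
  · rw [LinearMap.sub_apply, totalNumber_basis hB, h.1, Fintype.card_fin, Nat.cast_sub hk,
      Module.End.natCast_apply, ← Nat.cast_smul_eq_nsmul ℝ]
    push_cast
    module
  · rw [map_zero, smul_zero]

/-- The trace of a polynomial in the basic Laplacian over the range of a projection. -/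
theorem trace_aeval_basicLaplacian_mul_proj (hn : 1 ≤ n) {k m : ℕ} (hk : k ≤ n) (hm : m ≤ n - k)
    (f : Polynomial ℝ) :
    LinearMap.trace ℝ (BasicForms n)
        (Polynomial.aeval (metricPair n).basicLaplacian f * proj B k m) =
      ∑ j ∈ Finset.range (min m (n - k - m) + 1),
        multiplicity n k j * f.eval (((m - j) * (n - k - m - j + 1) : ℕ) : ℝ) := by
  rw [basicLaplacian_eq hn]
  refine trace_aeval_mul_proj (A := End ℝ (BasicForms n)) (π := proj B k)
    (LinearMap.trace_mul_comm ℝ) (pairCreation_mul_proj hB k)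
    (pairAnnihilation_mul_proj hB k) (pairAnnihilation_mul_proj_zero hB k)
    (commutator_mul_proj hB hk) (multiplicity n k) ?_ ?_ ?_ m hm f
  · rw [multiplicity_zero, trace_proj, Nat.choose_zero_right, Nat.cast_one, mul_one]
  · intro j hj
    rw [multiplicity_succ (by omega), trace_proj, trace_proj]
    ring
  · intro j hj
    rw [trace_proj, trace_proj, Nat.choose_symm hj]

/-- The numbers in the trace formula are eigenvalues of the basic Laplacian. -/
theorem isRoot_minpoly (hn : 1 ≤ n) {k m j : ℕ} (hk : k ≤ n) (hm : m ≤ n - k)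
    (hj : j ≤ min m (n - k - m)) : (minpoly ℝ (metricPair n).basicLaplacian).eval
      (((m - j) * (n - k - m - j + 1) : ℕ) : ℝ) = 0 := by
  -- The square of the minimal polynomial annihilates the Laplacian and takes nonnegative values, so
  -- the trace formula becomes a vanishing sum of nonnegative terms with positive weights.
  have h := trace_aeval_basicLaplacian_mul_proj hB hn hk hm
    (minpoly ℝ (metricPair n).basicLaplacian ^ 2)
  rw [aeval_minpoly_sq, zero_mul, map_zero, eq_comm,
    Finset.sum_eq_zero_iff_of_nonneg] at h
  · have h1 := h j (Finset.mem_range.2 (by omega))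
    rw [Polynomial.eval_pow] at h1
    exact pow_eq_zero_iff two_ne_zero |>.1
      ((mul_eq_zero.1 h1).resolve_left (multiplicity_pos (by omega)).ne')
  · intro i hi
    rw [Finset.mem_range] at hi
    rw [Polynomial.eval_pow]
    exact mul_nonneg (multiplicity_pos (by omega)).le (sq_nonneg _)

end Projections

end Heisenberg

end TwoStep

end

/-! ### The partition function -/

theorem theorem5p9 (n : ℕ) (hn : 1 ≤ n) (s t : ℝ) (hs : 0 ≤ s) :
    (TwoStep.Heisenberg.metricPair n).basicPartitionFunction s t =
      ∑ k ∈ Finset.range (n + 1), ∑ m ∈ Finset.range (n - k + 1),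
        ∑ j ∈ Finset.range (min m (n - k - m) + 1),
          TwoStep.Heisenberg.multiplicity n k j *
            s ^ ((m - j) * (n - k - m - j + 1)) * t ^ (2 * m + k) := by
  obtain ⟨B, hB, hdeg⟩ := TwoStep.Heisenberg.exists_basicForms_basis hn
  rw [TwoStep.MetricPair.basicPartitionFunction, TwoStep.Heisenberg.degPow_restrict_eq B hdeg,
    Finset.mul_sum, map_sum]
  refine Finset.sum_congr rfl fun k hk => ?_
  rw [Finset.mul_sum, map_sum]
  refine Finset.sum_congr rfl fun m hm => ?_
  rw [Finset.mem_range] at hk hm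
  rw [mul_smul_comm, map_smul, TwoStep.rpowEnd,
    TwoStep.Heisenberg.trace_aeval_basicLaplacian_mul_proj hB hn (by omega) (by omega),
    smul_eq_mul, Finset.mul_sum]
  refine Finset.sum_congr rfl fun j hj => ?_
  rw [Finset.mem_range] at hj
  -- The interpolating polynomial is known to agree with s^x only at its nodes, so the eigenvalue
  -- must be one of them.
  have hroot : (((m - j) * (n - k - m - j + 1) : ℕ) : ℝ) ∈
      (minpoly ℝ (TwoStep.Heisenberg.metricPair n).basicLaplacian).roots.toFinset := by
    rw [Multiset.mem_toFinset,
      Polynomial.mem_roots (minpoly.ne_zero (Algebra.IsIntegral.isIntegral _))]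
    exact TwoStep.Heisenberg.isRoot_minpoly hB hn (by omega) (by omega) (by omega)
  have heval := Lagrange.eval_interpolate_at_node (v := id) (fun x : ℝ => s ^ x)
    (Set.injOn_id _) hroot
  rw [id_eq, Real.rpow_natCast] at heval
  rw [heval]
  ring
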